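/- Let $R$ be an associative ring with unit and let $M$ be an $R$-bimodule that is $N$-nilpotent for some integer $N\ge 0$, i.e. $M^{\otimes_R(N+1)}=0$, where $M^{\otimes_R 0}=R$ and $M^{\otimes_R(i+1)}=M\otimes_R M^{\otimes_R i}$. Let $T_R(M)=\bigoplus_{i=0}^N M^{\otimes_R i}$ be the tensor ring. Modules are left modules. A $T_R(M)$-module is the same thing as a pair $(X,u)$ of an $R$-module $X$ and an $R$-homomorphism $u\colon M\otimes_R X\to X$ (where $u(m\otimes x)=mx$). For an $R$-module $X$, let $\mathrm{Ind}(X)$ be the $T_R(M)$-module $\big(\bigoplus_{i=0}^N M^{\otimes_R i}\otimes_R X,\,c_X\big)$, where $c_X$ is the map that takes $M\otimes_R(M^{\otimes_R i}\otimes_R X)$ identically to the summand $M^{\otimes_R(i+1)}\otimes_R X$; thus $\mathrm{Ind}(X)\cong T_R(M)\otimes_R X$. For a ring $A$, a complete projective resolution of $A$-modules is an exact sequence $Q^\bullet=(\cdots\to Q^{-1}\to Q^0\to Q^1\to\cdots)$ of projective $A$-modules, indexed by $\mathbb Z$, that remains exact under $\mathrm{Hom}_A(-,P)$ for every projective $A$-module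 $P$. An $A$-module is Gorenstein projective if it is isomorphic to $\ker(Q^0\to Q^1)$ for some complete projective resolution $Q^\bullet$; $\mathrm{GP}(A)$ denotes the class of these modules. Suppose that $M$ is compatible: for every complete projective resolution $Q^\bullet$ of $T_R(M)$-modules, (C1) the complex $M\otimes_R Q^\bullet$ is exact, and (C2) the complex $\mathrm{Hom}_{T_R(M)}(Q^\bullet,\mathrm{Ind}(M\otimes_R P))$ is exact for every projective $R$-module $P$. Suppose also that $M$ is admissible: for every $G\in\mathrm{GP}(R)$, every projective $R$-module $P$ and every $i\ge 0$, $$\mathrm{Ext}^1_R(G,M^{\otimes_R i}\otimes_R P)=0=\mathrm{Tor}_1^R(M,M^{\otimes_R i}\otimes_R G).$$ Then $\mathrm{GP}(T_R(M))=\Phi(\mathrm{GP}(R))$, where $\Phi(\mathrm{GP}(R))$ is the class of the $T_R(M)$-modules $(X,u)$ such that $u$ is injective and $\mathrm{coker}(u)\in\mathrm{GP}(R)$. That is, a $T_R(M)$-module $(X,u)$ is Gorenstein projective if and only if $u$ is injective and $\mathrm{coker}(u)$ is a Gorenstein projective $R$-module. -/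

import Mathlib

open CategoryTheory TensorProduct MulOpposite

universe u

noncomputable section

namespace TensorRingGP

section BalancedTensor

variable (R : Type u) [Ring R]
variable (M : Type u) [AddCommGroup M] [Module R M] [Module Rᵐᵒᵖ M]
variable (X : Type u) [AddCommGroup X] [Module R X]

/-- For an `R`-bimodule `M` (commuting left and right actions, the right one written as an action
of `Rᵐᵒᵖ`), the relations `(m r) ⊗ x = m ⊗ (r x)`. The set of differences is stable under left
multiplication by `R`, so its left `R`-span is the additive subgroup that it generates. -/
def balancedRelations : Submodule R (M ⊗[ℤ] X) :=
  Submodule.span R {t | ∃ (m : M) (r : R) (x : X), t = (op r • m) ⊗ₜ[ℤ] x - m ⊗ₜ[ℤ] (r • x)}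

/-- The tensor product `M ⊗_R X` of an `R`-bimodule `M` and a left `R`-module `X` over a
not necessarily commutative ring `R`, as a left `R`-module. -/
def BTensor : Type u := (M ⊗[ℤ] X) ⧸ balancedRelations R M X

instance : AddCommGroup (BTensor R M X) :=
  inferInstanceAs (AddCommGroup ((M ⊗[ℤ] X) ⧸ balancedRelations R M X))

instance : Module R (BTensor R M X) :=
  inferInstanceAs (Module R ((M ⊗[ℤ] X) ⧸ balancedRelations R M X))

variable {M X}

/-- The pure tensor `m ⊗ x`. -/
def btmul (m : M) (x : X) : BTensor R M X :=
  (balancedRelations R M X).mkQ (m ⊗ₜ[ℤ] x)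

theorem btmul_add (m : M) (x y : X) : btmul R m (x + y) = btmul R m x + btmul R m y := by
  simp only [btmul, TensorProduct.tmul_add]
  exact map_add _ _ _

theorem btmul_zero (m : M) : btmul R m (0 : X) = 0 := by
  simp only [btmul, TensorProduct.tmul_zero]
  exact map_zero _

theorem add_btmul (m n : M) (x : X) : btmul R (m + n) x = btmul R m x + btmul R n x := by
  simp only [btmul, TensorProduct.add_tmul]
  exact map_add _ _ _

theorem smul_btmul (r : R) (m : M) (x : X) : btmul R (r • m) x = r • btmul R m x := by
  simp only [btmul, ← TensorProduct.smul_tmul']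
  exact map_smul (balancedRelations R M X).mkQ _ _

theorem op_smul_btmul (r : R) (m : M) (x : X) : btmul R (op r • m) x = btmul R m (r • x) := by
  refine (Submodule.Quotient.eq _).2 (Submodule.subset_span ⟨m, r, x, rfl⟩)

variable {R}

theorem btensor_induction {p : BTensor R M X → Prop} (t : BTensor R M X)
    (zero : p 0) (tmul : ∀ m x, p (btmul R m x)) (add : ∀ s t, p s → p t → p (s + t)) : p t := by
  obtain ⟨t, rfl⟩ := Submodule.mkQ_surjective (balancedRelations R M X) t
  induction t using TensorProduct.induction_on with
  | zero => rw [map_zero]; exact zero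
  | tmul m x => exact tmul m x
  | add s t hs ht => rw [map_add]; exact add _ _ hs ht

/-- The universal property of `M ⊗_R X`. -/
def btlift {Y : Type*} [AddCommGroup Y] [Module R Y] (f : M → X → Y)
    (hadd : ∀ m n x, f (m + n) x = f m x + f n x)
    (addh : ∀ m x y, f m (x + y) = f m x + f m y)
    (hsmul : ∀ (r : R) m x, f (r • m) x = r • f m x)
    (hbal : ∀ (r : R) m x, f (op r • m) x = f m (r • x)) : BTensor R M X →ₗ[R] Y :=
  (balancedRelations R M X).liftQ
    (TensorProduct.AlgebraTensorModule.lift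
      { toFun := fun m => (AddMonoidHom.mk' (f m) (addh m)).toIntLinearMap
        map_add' := fun m n => by ext x; exact hadd m n x
        map_smul' := fun r m => by ext x; exact hsmul r m x })
    (by
      rw [balancedRelations, Submodule.span_le]
      rintro _ ⟨m, r, x, rfl⟩
      simp [hbal])

@[simp]
theorem btlift_btmul {Y : Type*} [AddCommGroup Y] [Module R Y] (f : M → X → Y)
    (hadd addh hsmul hbal) (m : M) (x : X) :
    btlift (R := R) f hadd addh hsmul hbal (btmul R m x) = f m x := rfl

variable (R M)

/-- `M ⊗ f : M ⊗_R X → M ⊗_R Y` for an `R`-linear map `f : X → Y`. -/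
def btmap {Y : Type u} [AddCommGroup Y] [Module R Y] (f : X →ₗ[R] Y) :
    BTensor R M X →ₗ[R] BTensor R M Y :=
  btlift (fun m x => btmul R m (f x))
    (fun _ _ _ => add_btmul R _ _ _) (fun _ _ _ => by rw [map_add, btmul_add])
    (fun _ _ _ => smul_btmul R _ _ _) (fun _ _ _ => by rw [op_smul_btmul, map_smul])

@[simp]
theorem btmap_btmul {Y : Type u} [AddCommGroup Y] [Module R Y] (f : X →ₗ[R] Y) (m : M) (x : X) :
    btmap R M f (btmul R m x) = btmul R m (f x) := rfl

/-- The functor `M ⊗_R -`. -/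
def tensorFunctor : ModuleCat.{u} R ⥤ ModuleCat.{u} R where
  obj X := ModuleCat.of R (BTensor R M X)
  map f := ModuleCat.ofHom (btmap R M f.hom)
  map_id X := by
    ext t
    induction t using btensor_induction with
    | zero => simp
    | tmul m x => rfl
    | add s t hs ht => rw [map_add, map_add, hs, ht]
  map_comp f g := by
    ext t
    induction t using btensor_induction with
    | zero => simp
    | tmul m x => rfl
    | add s t hs ht => rw [map_add, map_add, hs, ht]

instance : (tensorFunctor R M).Additive where
  map_add {X Y f g} := by
    have h : btmap R M (f + g).hom = btmap R M f.hom + btmap R M g.hom := by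
      ext t
      induction t using btensor_induction with
      | zero => rw [map_zero, map_zero]
      | tmul m x => exact btmul_add R _ _ _
      | add s t hs ht => rw [map_add, map_add, hs, ht]
    exact congrArg ModuleCat.ofHom h

/-- `Tor_n^R(M, X)`: the left derived functors of `M ⊗_R -`. -/
def Tor (n : ℕ) (X : ModuleCat.{u} R) : ModuleCat.{u} R :=
  ((tensorFunctor R M).leftDerived n).obj X

/-- `M^{⊗ i} ⊗_R X`, bracketed to the right: `M ⊗ (M ⊗ (⋯ ⊗ (M ⊗ X)))`. -/
def tensorPow : ℕ → ModuleCat.{u} R → ModuleCat.{u} R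
  | 0, X => X
  | i + 1, X => ModuleCat.of R (BTensor R M (tensorPow i X))

/-- The bimodule `M` is `N`-nilpotent: `M^{⊗ (N + 1)} = 0`. -/
def IsNilpotentBimodule (N : ℕ) : Prop :=
  Subsingleton (tensorPow R M (N + 1) (ModuleCat.of R R))

/-- The pure tensor `m ⊗ y` in `M^{⊗ (i + 1)} ⊗_R X`, for `y` in `M^{⊗ i} ⊗_R X`. -/
def consTensor {X : ModuleCat.{u} R} (i : ℕ) (m : M) (y : tensorPow R M i X) :
    tensorPow R M (i + 1) X :=
  btmul R m y

end BalancedTensor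

section TensorRing

variable (R : Type u) [Ring R]
variable (M : Type u) [AddCommGroup M] [Module R M] [Module Rᵐᵒᵖ M]

/-- The left `R`-module `⨁ i, M^{⊗ i} ⊗_R X`. If `M` is `N`-nilpotent, the terms with
`i > N` are zero. -/
abbrev IndCarrier (X : ModuleCat.{u} R) : Type u := DirectSum ℕ fun i => tensorPow R M i X

/-- `y ↦ m ⊗ y`, taking `M^{⊗ i} ⊗_R X` to `M^{⊗ (i + 1)} ⊗_R X`. -/
def shift (X : ModuleCat.{u} R) (m : M) : IndCarrier R M X →+ IndCarrier R M X :=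
  DirectSum.toAddMonoid fun i =>
    (DirectSum.of (fun i => tensorPow R M i X) (i + 1)).comp
      (AddMonoidHom.mk' (consTensor R M i m) fun y z => btmul_add R m y z)

theorem shift_of (X : ModuleCat.{u} R) (m : M) (i : ℕ) (y : tensorPow R M i X) :
    shift R M X m (DirectSum.of (fun i => tensorPow R M i X) i y) =
      DirectSum.of (fun i => tensorPow R M i X) (i + 1) (consTensor R M i m y) :=
  DirectSum.toAddMonoid_of _ _ _

theorem smul_of (X : ModuleCat.{u} R) (r : R) (i : ℕ) (y : tensorPow R M i X) :
    r • DirectSum.of (fun i => tensorPow R M i X) i y =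
      DirectSum.of (fun i => tensorPow R M i X) i (r • y) :=
  ((DirectSum.lof R ℕ (fun i => tensorPow R M i X) i).map_smul r y).symm

/-- The structure map `c_X : M ⊗_R (⨁ i, M^{⊗ i} ⊗_R X) → ⨁ i, M^{⊗ i} ⊗_R X`. -/
def indMap (X : ModuleCat.{u} R) : BTensor R M (IndCarrier R M X) →ₗ[R] IndCarrier R M X :=
  btlift (fun m x => shift R M X m x)
    (fun m n x => by
      induction x using DirectSum.induction_on with
      | zero => simp
      | of i y =>
        simp only [shift_of, ← map_add]
        exact congrArg _ (add_btmul R m n y)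
      | add x y hx hy => simp only [map_add, hx, hy]; abel)
    (fun m x y => map_add _ _ _)
    (fun r m x => by
      induction x using DirectSum.induction_on with
      | zero => simp
      | of i y =>
        simp only [shift_of, smul_of]
        exact congrArg _ (smul_btmul R r m y)
      | add x y hx hy => simp only [map_add, hx, hy, smul_add])
    (fun r m x => by
      induction x using DirectSum.induction_on with
      | zero => simp
      | of i y =>
        simp only [shift_of, smul_of]
        exact congrArg _ (op_smul_btmul R r m y)
      | add x y hx hy => simp only [map_add, hx, hy, smul_add])

/-- The underlying additive group `⨁ i, M^{⊗ i}` of the tensor ring `T_R(M)`. If `M` is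
`N`-nilpotent, this is `⨁_{i = 0}^N M^{⊗ i}`. -/
def TensorRing : Type u := IndCarrier R M (ModuleCat.of R R)

instance : AddCommGroup (TensorRing R M) :=
  inferInstanceAs (AddCommGroup (IndCarrier R M (ModuleCat.of R R)))

instance : Module R (TensorRing R M) :=
  inferInstanceAs (Module R (IndCarrier R M (ModuleCat.of R R)))

namespace TensorRing

/-- The summand `M^{⊗ i}` of `T_R(M)`. -/
def of (i : ℕ) : tensorPow R M i (ModuleCat.of R R) →ₗ[R] TensorRing R M :=
  DirectSum.lof R ℕ (fun i => tensorPow R M i (ModuleCat.of R R)) i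

/-- The summand `R = M^{⊗ 0}` of `T_R(M)`. -/
def base : R →ₗ[R] TensorRing R M := of R M 0

/-- The map `M ⊗_R T_R(M) → T_R(M)`, `m ⊗ t ↦ m ⊗ t`. -/
def cons : BTensor R M (TensorRing R M) →ₗ[R] TensorRing R M := indMap R M (ModuleCat.of R R)

variable {R M}

theorem cons_of (i : ℕ) (m : M) (y : tensorPow R M i (ModuleCat.of R R)) :
    cons R M (btmul R m (of R M i y)) = of R M (i + 1) (consTensor R M i m y) :=
  shift_of R M (ModuleCat.of R R) m i y

theorem induction_of {p : TensorRing R M → Prop} (t : TensorRing R M) (zero : p 0)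
    (of : ∀ i y, p (of R M i y)) (add : ∀ s t, p s → p t → p (s + t)) : p t :=
  DirectSum.induction_on t zero of add

theorem induction {p : TensorRing R M → Prop} (t : TensorRing R M)
    (base : ∀ r : R, p (base R M r)) (cons : ∀ m t, p t → p (cons R M (btmul R m t)))
    (add : ∀ s t, p s → p t → p (s + t)) : p t := by
  have zero : p 0 := by simpa using base 0
  refine induction_of t zero (fun i y => ?_) add
  induction i with
  | zero => exact base y
  | succ i ih =>
    refine btensor_induction (p := fun y => p (of R M (i + 1) y)) y ?_ ?_ ?_
    · exact (map_zero (of R M (i + 1))).symm ▸ zero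
    · exact fun m y => cons_of i m y ▸ cons m _ (ih y)
    · intro s t hs ht
      exact (map_add (of R M (i + 1)) s t).symm ▸ add _ _ hs ht

end TensorRing

variable {R M}
variable {X : Type u} [AddCommGroup X] [Module R X]

/-- The action `(m₁ ⊗ ⋯ ⊗ mᵢ ⊗ r) x = u (m₁ ⊗ u (m₂ ⊗ ⋯ u (mᵢ ⊗ r x)))` of `M^{⊗ i}` on `X`
that a linear map `u : M ⊗_R X → X` induces. -/
def powAct (u : BTensor R M X →ₗ[R] X) :
    (i : ℕ) → tensorPow R M i (ModuleCat.of R R) →ₗ[R] (X →+ X)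
  | 0 => LinearMap.toSpanSingleton R (X →+ X) (AddMonoidHom.id X)
  | i + 1 => btlift
      (fun m y => AddMonoidHom.mk' (fun x => u (btmul R m (powAct u i y x)))
        fun a b => by rw [map_add, btmul_add, map_add])
      (fun m n y => by ext x; simp [add_btmul])
      (fun m y z => by ext x; simp [btmul_add])
      (fun r m y => by ext x; simp [smul_btmul])
      (fun r m y => by ext x; simp [op_smul_btmul])

/-- The action of `T_R(M)` on `X` that a linear map `u : M ⊗_R X → X` induces. -/
def act (u : BTensor R M X →ₗ[R] X) : TensorRing R M →ₗ[R] (X →+ X) :=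
  DirectSum.toModule R ℕ (X →+ X) (powAct u)

theorem act_of (u : BTensor R M X →ₗ[R] X) (i : ℕ) (y : tensorPow R M i (ModuleCat.of R R)) :
    act u (TensorRing.of R M i y) = powAct u i y :=
  DirectSum.toModule_lof (M := fun i => tensorPow R M i (ModuleCat.of R R))
    (φ := powAct u) R i y

theorem act_base (u : BTensor R M X →ₗ[R] X) (r : R) (x : X) :
    act u (TensorRing.base R M r) x = r • x :=
  DFunLike.congr_fun (act_of u 0 r) x

theorem act_cons (u : BTensor R M X →ₗ[R] X) (m : M) (t : TensorRing R M) (x : X) :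
    act u (TensorRing.cons R M (btmul R m t)) x = u (btmul R m (act u t x)) := by
  induction t using TensorRing.induction_of with
  | zero => simp [btmul_zero]
  | of i y =>
    rw [TensorRing.cons_of, act_of, act_of]
    rfl
  | add s t hs ht => simp [btmul_add, hs, ht]

instance : Mul (TensorRing R M) where
  mul s t := act (TensorRing.cons R M) s t

instance : One (TensorRing R M) where
  one := TensorRing.base R M 1

theorem mul_eq_act (s t : TensorRing R M) : s * t = act (TensorRing.cons R M) s t := rfl

theorem base_mul (r : R) (t : TensorRing R M) : TensorRing.base R M r * t = r • t :=
  act_base _ r t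

theorem cons_mul (m : M) (s t : TensorRing R M) :
    TensorRing.cons R M (btmul R m s) * t = TensorRing.cons R M (btmul R m (s * t)) :=
  act_cons _ m s t

theorem act_one (u : BTensor R M X →ₗ[R] X) (x : X) : act u 1 x = x :=
  (act_base u 1 x).trans (one_smul R x)

theorem act_mul (u : BTensor R M X →ₗ[R] X) (s t : TensorRing R M) (x : X) :
    act u (s * t) x = act u s (act u t x) := by
  induction s using TensorRing.induction with
  | base r => simp [base_mul, act_base]
  | cons m s ih => rw [cons_mul, act_cons, act_cons, ih]
  | add a b ha hb =>
    rw [mul_eq_act] at ha hb ⊢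
    simp [ha, hb]

theorem tensorRing_mul_one (s : TensorRing R M) : s * 1 = s := by
  induction s using TensorRing.induction with
  | base r =>
    rw [base_mul]
    exact (map_smul (TensorRing.base R M) r 1).symm.trans (by simp)
  | cons m s ih => rw [cons_mul, ih]
  | add a b ha hb =>
    rw [mul_eq_act] at ha hb ⊢
    simp [ha, hb]

/-- The tensor ring `T_R(M)`, with `(m₁ ⊗ ⋯ ⊗ mᵢ) (n₁ ⊗ ⋯ ⊗ nⱼ) = m₁ ⊗ ⋯ ⊗ mᵢ ⊗ n₁ ⊗ ⋯ ⊗ nⱼ`. -/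
instance : Ring (TensorRing R M) :=
  { (inferInstance : AddCommGroup (TensorRing R M)),
    (inferInstance : Mul (TensorRing R M)), (inferInstance : One (TensorRing R M)) with
    mul_assoc := fun a b c => act_mul (TensorRing.cons R M) a b c
    one_mul := fun a => act_one (TensorRing.cons R M) a
    mul_one := tensorRing_mul_one
    left_distrib := fun a b c => map_add (act (TensorRing.cons R M) a) b c
    right_distrib := fun a b c => by simp [mul_eq_act]
    zero_mul := fun a => by simp [mul_eq_act]
    mul_zero := fun a => by simp [mul_eq_act] }

variable (R M)

/-- The inclusion of `R = M^{⊗ 0}` in `T_R(M)`. -/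
def baseHom : R →+* TensorRing R M where
  toFun r := TensorRing.base R M r
  map_one' := rfl
  map_mul' r s := (map_smul (TensorRing.base R M) r s).trans (base_mul r _).symm
  map_zero' := map_zero _
  map_add' := map_add _

/-- The inclusion of `M = M^{⊗ 1}` in `T_R(M)`. -/
def bimoduleIncl (m : M) : TensorRing R M := TensorRing.cons R M (btmul R m 1)

theorem bimoduleIncl_add (m n : M) :
    bimoduleIncl R M (m + n) = bimoduleIncl R M m + bimoduleIncl R M n := by
  simp [bimoduleIncl, add_btmul]

theorem bimoduleIncl_smul (r : R) (m : M) :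
    bimoduleIncl R M (r • m) = baseHom R M r * bimoduleIncl R M m := by
  rw [bimoduleIncl, smul_btmul, map_smul]
  exact (base_mul r _).symm

theorem bimoduleIncl_op_smul (r : R) (m : M) :
    bimoduleIncl R M (op r • m) = bimoduleIncl R M m * baseHom R M r := by
  rw [bimoduleIncl, bimoduleIncl, cons_mul, one_mul, op_smul_btmul, ← base_mul, mul_one]
  rfl

variable {R M}

/-- The ring homomorphism `T_R(M) → End_ℤ(X)` that a linear map `u : M ⊗_R X → X` induces. -/
def actHom (u : BTensor R M X →ₗ[R] X) : TensorRing R M →+* AddMonoid.End X where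
  toFun t := act u t
  map_one' := by ext x; exact act_one u x
  map_mul' s t := by ext x; exact act_mul u s t x
  map_zero' := map_zero (act u)
  map_add' := map_add (act u)

/-- The `T_R(M)`-module that corresponds to the pair `(X, u)`. -/
def ofPair (u : BTensor R M X →ₗ[R] X) : ModuleCat.{u} (TensorRing R M) :=
  letI : Module (TensorRing R M) X := Module.compHom X (actHom u)
  ModuleCat.of (TensorRing R M) X

variable (R M)

/-- The functor `Ind` on objects: the `T_R(M)`-module `(⨁ i, M^{⊗ i} ⊗_R X, c_X)`. -/
def Ind (X : ModuleCat.{u} R) : ModuleCat.{u} (TensorRing R M) :=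
  ofPair (indMap R M X)

/-- The forgetful functor from `T_R(M)`-modules to `R`-modules. -/
abbrev forgetToBase : ModuleCat.{u} (TensorRing R M) ⥤ ModuleCat.{u} R :=
  ModuleCat.restrictScalars (baseHom R M)

/-- The map `u : M ⊗_R X → X`, `m ⊗ x ↦ m x`, of the pair `(X, u)` that corresponds to a
`T_R(M)`-module `X`. -/
def structureMap (X : ModuleCat.{u} (TensorRing R M)) :
    BTensor R M ((forgetToBase R M).obj X) →ₗ[R] (forgetToBase R M).obj X :=
  btlift (X := (forgetToBase R M).obj X)
    (fun m x => (show (forgetToBase R M).obj X from bimoduleIncl R M m • (show X from x)))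
    (fun m n x => (congrArg (· • (show X from x)) (bimoduleIncl_add R M m n)).trans
      (add_smul _ _ (show X from x)))
    (fun m x y => smul_add (bimoduleIncl R M m) (show X from x) (show X from y))
    (fun r m x => (congrArg (· • (show X from x)) (bimoduleIncl_smul R M r m)).trans
      (mul_smul _ _ (show X from x)))
    (fun r m x => (congrArg (· • (show X from x)) (bimoduleIncl_op_smul R M r m)).trans
      (mul_smul _ _ (show X from x)))

/-- `Φ(𝒳)`: the `T_R(M)`-modules `(X, u)` with `u` injective and cokernel of `u` in `𝒳`. -/
def Phi (P : ObjectProperty (ModuleCat.{u} R)) :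
    ObjectProperty (ModuleCat.{u} (TensorRing R M)) := fun X =>
  Function.Injective (structureMap R M X) ∧
    P (ModuleCat.of R ((forgetToBase R M).obj X ⧸ LinearMap.range (structureMap R M X)))

end TensorRing

section Gorenstein

variable (A : Type u) [Ring A]

/-- Complete projective resolutions: exact sequences of projective modules that remain exact
under `Hom_A(-, P)` for every projective module `P`. -/
structure CompleteProjectiveResolution where
  X : ℤ → ModuleCat.{u} A
  d : ∀ i, X i →ₗ[A] X (i + 1)
  projective : ∀ i, Module.Projective A (X i)
  exact : ∀ i, Function.Exact (d i) (d (i + 1))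
  hom_exact : ∀ P : ModuleCat.{u} A, Module.Projective A P → ∀ i,
    Function.Exact (fun f : X (i + 1 + 1) →ₗ[A] P => f ∘ₗ d (i + 1))
      (fun f : X (i + 1) →ₗ[A] P => f ∘ₗ d i)

/-- The Gorenstein projective modules. -/
def GP : ObjectProperty (ModuleCat.{u} A) := fun G =>
  ∃ Q : CompleteProjectiveResolution A, Nonempty (G ≃ₗ[A] LinearMap.ker (Q.d 0))

end Gorenstein

section Conditions

variable (R : Type u) [Ring R]
variable (M : Type u) [AddCommGroup M] [Module R M] [Module Rᵐᵒᵖ M]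
variable (B : Type u) [AddCommGroup B] [Module R B] [Module Rᵐᵒᵖ B]

/-- The `R`-bimodule `B` is compatible (relative to the tensor ring `T_R(M)`): for every complete
projective resolution `Q` of `T_R(M)`-modules, `B ⊗_R Q` is exact, and `Hom(Q, Ind(B ⊗_R P))` is
exact for every projective `R`-module `P`. -/
def IsCompatible : Prop :=
  ∀ Q : CompleteProjectiveResolution (TensorRing R M),
    (∀ i, Function.Exact
      (btmap R B ((forgetToBase R M).map (ModuleCat.ofHom (Q.d i))).hom)
      (btmap R B ((forgetToBase R M).map (ModuleCat.ofHom (Q.d (i + 1)))).hom)) ∧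
    ∀ P : ModuleCat.{u} R, Module.Projective R P → ∀ i,
      Function.Exact
        (fun f : Q.X (i + 1 + 1) →ₗ[TensorRing R M] Ind R M (ModuleCat.of R (BTensor R B P)) =>
          f ∘ₗ Q.d (i + 1))
        (fun f : Q.X (i + 1) →ₗ[TensorRing R M] Ind R M (ModuleCat.of R (BTensor R B P)) =>
          f ∘ₗ Q.d i)

/-- The `R`-bimodule `B` is admissible: `Ext¹_R(G, B^{⊗ i} ⊗_R P) = 0 = Tor₁^R(B, B^{⊗ i} ⊗_R G)`
for all Gorenstein projective `G`, projective `P` and `i ≥ 0`. -/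
def IsAdmissible : Prop :=
  ∀ G : ModuleCat.{u} R, GP R G → ∀ P : ModuleCat.{u} R, Module.Projective R P → ∀ i : ℕ,
    Subsingleton (Abelian.Ext G (tensorPow R B i P) 1) ∧
      Subsingleton (Tor R B 1 (tensorPow R B i G))

end Conditions

end TensorRingGP

end

/-!
Write `u : M ⊗ X → X` for the structure map of a `T_R(M)`-module `X` and `X / M X` for its cokernel.
A module is Gorenstein projective if and only if it is a term of a sequence of modules, indexed
by `ℤ`, in which each term is a cosyzygy of the previous one, so both inclusions can be checked
one short exact sequence at a time.

Let `K` run over the kernels of a complete projective resolution `Q` of `T_R(M)`-modules. Since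
`M ⊗ Q` is exact, `M ⊗ K → M ⊗ Qⁿ` is injective, and the structure map of `K` is injective because
that of `Qⁿ` is. Hence `K ↦ K / M K` keeps the short exact sequences of `Q` exact. Maps from
`K / M K` to a projective `R`-module `P` are the `T_R(M)`-linear maps from `K` to `P` with zero
`M`-action; they extend because of `0 → Ind(M ⊗ P) → Ind(P) → P → 0` and the exactness of
`Hom(Q, Ind(M ⊗ P))`.

Conversely, let `u` be injective with `X / M X` Gorenstein projective. A surjection `P → X / M X`
and an injection `X / M X → P` with Gorenstein projective kernel and cokernel lift to a surjection
`Ind(P) → X` and to an injection `X → Ind(P)`. The lifts exist because `Ext¹(X, Ind(M ⊗ P)) = 0`,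
which follows from the same short exact sequences, applied to the `M^{⊗ i} ⊗ P`, by descending
induction on `i`. Surjectivity is Nakayama's lemma, and injectivity is a descending induction over
the `M^{⊗ i} ⊗ X`, which uses the vanishing of `Tor`. The kernel and the cokernel of the lifts are
modules of the same kind.
-/

noncomputable section

namespace TensorRingGP

/-! ### Short exact sequences -/

section ShortExact

variable {A : Type*} [Ring A] {W X Y Z : Type*} [AddCommGroup W] [Module A W]
  [AddCommGroup X] [Module A X] [AddCommGroup Y] [Module A Y] [AddCommGroup Z] [Module A Z]

/-- The sequence `0 → X → Y → Z → 0` with maps `i` and `p` is exact. -/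
structure IsShortExact (i : X →ₗ[A] Y) (p : Y →ₗ[A] Z) : Prop where
  injective : Function.Injective i
  exact : Function.Exact i p
  surjective : Function.Surjective p

theorem isShortExact_subtype_ker {p : Y →ₗ[A] Z} (hp : Function.Surjective p) :
    IsShortExact (LinearMap.ker p).subtype p :=
  ⟨Submodule.subtype_injective _, LinearMap.exact_subtype_ker_map p, hp⟩

theorem exists_lift_of_exact {i : X →ₗ[A] Y} {p : Y →ₗ[A] Z} (h : Function.Exact i p)
    (hi : Function.Injective i) (f : W →ₗ[A] Y) (hf : p ∘ₗ f = 0) :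
    ∃ g : W →ₗ[A] X, i ∘ₗ g = f := by
  have hrange : ∀ w, f w ∈ LinearMap.range i := fun w => (h _).1 (LinearMap.congr_fun hf w)
  refine ⟨(LinearEquiv.ofInjective i hi).symm.toLinearMap ∘ₗ f.codRestrict _ hrange, ?_⟩
  ext w
  exact LinearEquiv.ofInjective_symm_apply (h := hi) i ⟨f w, hrange w⟩

theorem exists_desc_of_exact {i : X →ₗ[A] Y} {p : Y →ₗ[A] Z} (h : Function.Exact i p)
    (hp : Function.Surjective p) (f : Y →ₗ[A] W) (hf : f ∘ₗ i = 0) :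
    ∃ g : Z →ₗ[A] W, g ∘ₗ p = f := by
  refine ⟨(LinearMap.range i).liftQ f (LinearMap.range_le_ker_iff.2 hf) ∘ₗ
    (h.linearEquivOfSurjective hp).symm.toLinearMap, ?_⟩
  ext y
  simp

theorem IsShortExact.congr {i : X →ₗ[A] Y} {p : Y →ₗ[A] Z} (h : IsShortExact i p)
    {X' Y' Z' : Type*} [AddCommGroup X'] [Module A X'] [AddCommGroup Y'] [Module A Y']
    [AddCommGroup Z'] [Module A Z'] (e₁ : X' ≃ₗ[A] X) (e₂ : Y ≃ₗ[A] Y') (e₃ : Z ≃ₗ[A] Z') :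
    IsShortExact (e₂.toLinearMap ∘ₗ i ∘ₗ e₁.toLinearMap)
      (e₃.toLinearMap ∘ₗ p ∘ₗ e₂.symm.toLinearMap) where
  injective := e₂.injective.comp (h.injective.comp e₁.injective)
  exact y := by
    have := h.exact (e₂.symm y)
    simp only [LinearMap.comp_apply, LinearEquiv.coe_coe, Set.mem_range,
      LinearEquiv.map_eq_zero_iff, ← LinearEquiv.eq_symm_apply e₂] at this ⊢
    rw [this, e₁.surjective.exists]
  surjective := e₃.surjective.comp (h.surjective.comp e₂.symm.surjective)

theorem injective_of_exact_comp {f : X →ₗ[A] Y} {p : Y →ₗ[A] Z} {e : Z →ₗ[A] W}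
    (h : Function.Exact f (e ∘ₗ p)) (hpf : p ∘ₗ f = 0) (hp : Function.Surjective p) :
    Function.Injective e := by
  rw [injective_iff_map_eq_zero]
  intro z hz
  obtain ⟨y, rfl⟩ := hp z
  obtain ⟨x, rfl⟩ := (h y).1 hz
  exact LinearMap.congr_fun hpf x

theorem isShortExact_of_split {i : X →ₗ[A] Y} {p : Y →ₗ[A] Z} {r : Y →ₗ[A] X} {s : Z →ₗ[A] Y}
    (hri : r ∘ₗ i = LinearMap.id) (hps : p ∘ₗ s = LinearMap.id) (hpi : p ∘ₗ i = 0)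
    (h : i ∘ₗ r + s ∘ₗ p = LinearMap.id) : IsShortExact i p where
  injective := Function.LeftInverse.injective (LinearMap.congr_fun hri)
  exact := LinearMap.exact_of_comp_of_mem_range hpi fun y hy => ⟨r y, by
    simpa [hy] using LinearMap.congr_fun h y⟩
  surjective := Function.RightInverse.surjective (LinearMap.congr_fun hps)

/-- Two kernels of the same map are isomorphic. -/
def IsShortExact.kerEquiv {X' : Type*} [AddCommGroup X'] [Module A X'] {i : X →ₗ[A] Y}
    {i' : X' →ₗ[A] Y} {p : Y →ₗ[A] Z} (h : IsShortExact i p) (h' : IsShortExact i' p) :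
    X ≃ₗ[A] X' :=
  LinearEquiv.ofInjective i h.injective ≪≫ₗ
    LinearEquiv.ofEq _ _ (h.exact.linearMap_ker_eq.symm.trans h'.exact.linearMap_ker_eq) ≪≫ₗ
    (LinearEquiv.ofInjective i' h'.injective).symm

/-- Two cokernels of the same map are isomorphic. -/
def IsShortExact.cokerEquiv {Z' : Type*} [AddCommGroup Z'] [Module A Z'] {i : X →ₗ[A] Y}
    {p : Y →ₗ[A] Z} {p' : Y →ₗ[A] Z'} (h : IsShortExact i p) (h' : IsShortExact i p') :
    Z ≃ₗ[A] Z' :=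
  (h.exact.linearEquivOfSurjective h.surjective).symm ≪≫ₗ
    h'.exact.linearEquivOfSurjective h'.surjective

theorem exists_isShortExact_prod {K₀ P K L : Type*} [AddCommGroup K₀] [Module A K₀]
    [AddCommGroup P] [Module A P] [AddCommGroup K] [Module A K] [AddCommGroup L] [Module A L]
    {i₀ : K₀ →ₗ[A] P} {p₀ : P →ₗ[A] X} {i : K →ₗ[A] L} {p : L →ₗ[A] X}
    (h₀ : IsShortExact i₀ p₀) (h : IsShortExact i p) (φ : P →ₗ[A] L) (hφ : p ∘ₗ φ = p₀) :
    ∃ ψ : K₀ →ₗ[A] K, IsShortExact (i₀.prod (-ψ)) (φ.coprod i) := by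
  have hpφ : ∀ x, p (φ x) = p₀ x := LinearMap.congr_fun hφ
  obtain ⟨ψ, hψ⟩ := exists_lift_of_exact h.exact h.injective (φ ∘ₗ i₀) <| by
    rw [← LinearMap.comp_assoc, hφ, h₀.exact.linearMap_comp_eq_zero]
  have hiψ : ∀ y, i (ψ y) = φ (i₀ y) := LinearMap.congr_fun hψ
  refine ⟨ψ, fun y z e => h₀.injective congr(($e).1), ?_, fun l => ?_⟩
  · refine LinearMap.exact_of_comp_of_mem_range (by ext y; simp [hiψ]) ?_
    rintro ⟨x, k⟩ (hxk : φ x + i k = 0)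
    obtain ⟨y, rfl⟩ := (h₀.exact x).1 <| by
      rw [← hpφ, eq_neg_of_add_eq_zero_left hxk, map_neg, h.exact.apply_apply_eq_zero, neg_zero]
    refine ⟨y, Prod.ext rfl (h.injective ?_)⟩
    simpa [hiψ, neg_eq_iff_add_eq_zero] using hxk
  · obtain ⟨x, hx⟩ := h₀.surjective (p l)
    obtain ⟨k, hk⟩ := (h.exact (l - φ x)).1 (by rw [map_sub, hpφ, hx, sub_self])
    exact ⟨(x, k), by simp [hk]⟩

theorem exists_isShortExact_ker_comp {K L : Type*} [AddCommGroup K] [Module A K]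
    [AddCommGroup L] [Module A L] {i : X →ₗ[A] Y} {p : Y →ₗ[A] Z} {j : K →ₗ[A] L}
    {q : L →ₗ[A] Y} (h : IsShortExact i p) (hj : IsShortExact j q) :
    ∃ (j' : K →ₗ[A] LinearMap.ker (p ∘ₗ q)) (q' : LinearMap.ker (p ∘ₗ q) →ₗ[A] X),
      IsShortExact j' q' ∧ (LinearMap.ker (p ∘ₗ q)).subtype ∘ₗ j' = j := by
  have hjker : ∀ k, j k ∈ LinearMap.ker (p ∘ₗ q) := fun k => by
    simp [hj.exact.apply_apply_eq_zero]
  obtain ⟨q', hq'⟩ := exists_lift_of_exact h.exact h.injective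
    (q ∘ₗ (LinearMap.ker (p ∘ₗ q)).subtype) (LinearMap.ext fun l => l.2)
  have hiq : ∀ l, i (q' l) = q l := LinearMap.congr_fun hq'
  refine ⟨j.codRestrict _ hjker, q', ⟨fun a b e => hj.injective congr(($e).1),
    fun l => ?_, fun x => ?_⟩, rfl⟩
  · rw [← map_eq_zero_iff i h.injective, hiq, hj.exact]
    simp [Subtype.ext_iff]
  · obtain ⟨l, hl⟩ := hj.surjective (i x)
    refine ⟨⟨l, by simp [hl, h.exact.apply_apply_eq_zero]⟩, h.injective ?_⟩
    rw [hiq, hl]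

end ShortExact

/-! ### Balanced tensor products -/

section BalancedTensor

variable {R : Type u} [Ring R]
variable {M : Type u} [AddCommGroup M] [Module R M] [Module Rᵐᵒᵖ M]
variable {X Y Z : Type u} [AddCommGroup X] [Module R X] [AddCommGroup Y] [Module R Y]
  [AddCommGroup Z] [Module R Z]

theorem btensor_hom_ext {W : Type*} [AddCommGroup W] [Module R W] {f g : BTensor R M X →ₗ[R] W}
    (h : ∀ m x, f (btmul R m x) = g (btmul R m x)) : f = g := by
  ext t
  induction t using btensor_induction with
  | zero => rw [map_zero, map_zero]
  | tmul m x => exact h m x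
  | add s t hs ht => rw [map_add, map_add, hs, ht]

variable (R M)

theorem btmap_comp (g : Y →ₗ[R] Z) (f : X →ₗ[R] Y) :
    btmap R M (g ∘ₗ f) = btmap R M g ∘ₗ btmap R M f :=
  btensor_hom_ext fun _ _ => rfl

theorem btmap_id : btmap R M (LinearMap.id : X →ₗ[R] X) = LinearMap.id :=
  btensor_hom_ext fun _ _ => rfl

theorem btmap_zero : btmap R M (0 : X →ₗ[R] Y) = 0 :=
  btensor_hom_ext fun _ _ => btmul_zero R _

theorem btmap_leftInverse {g : Y →ₗ[R] X} {f : X →ₗ[R] Y} (h : Function.LeftInverse g f) :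
    Function.LeftInverse (btmap R M g) (btmap R M f) := fun t => by
  rw [← LinearMap.comp_apply, ← btmap_comp, show g ∘ₗ f = LinearMap.id from LinearMap.ext h,
    btmap_id, LinearMap.id_apply]

/-- The isomorphism `M ⊗_R X ≅ M ⊗_R Y` induced by `X ≅ Y`. -/
def btensorCongr (e : X ≃ₗ[R] Y) : BTensor R M X ≃ₗ[R] BTensor R M Y :=
  LinearEquiv.ofLinearMap (btmap R M e.toLinearMap) (btmap R M e.symm.toLinearMap)
    (by rw [← btmap_comp, LinearEquiv.comp_symm, btmap_id])
    (by rw [← btmap_comp, LinearEquiv.symm_comp, btmap_id])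

theorem btmap_surjective {f : X →ₗ[R] Y} (hf : Function.Surjective f) :
    Function.Surjective (btmap R M f) := by
  intro t
  induction t using btensor_induction with
  | zero => exact ⟨0, map_zero _⟩
  | tmul m y => obtain ⟨x, rfl⟩ := hf y; exact ⟨btmul R m x, rfl⟩
  | add s t hs ht =>
    obtain ⟨a, rfl⟩ := hs
    obtain ⟨b, rfl⟩ := ht
    exact ⟨a + b, map_add _ _ _⟩

theorem exists_comp_btmap_eq_mkQ {f : X →ₗ[R] Y} {g : Y →ₗ[R] Z} (h : Function.Exact f g)
    (hg : Function.Surjective g) :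
    ∃ φ : BTensor R M Z →ₗ[R] BTensor R M Y ⧸ LinearMap.range (btmap R M f),
      φ ∘ₗ btmap R M g = (LinearMap.range (btmap R M f)).mkQ := by
  have mkQ_eq : ∀ (m : M) (y y' : Y), g y = g y' →
      (LinearMap.range (btmap R M f)).mkQ (btmul R m y) =
        (LinearMap.range (btmap R M f)).mkQ (btmul R m y') := by
    intro m y y' e
    obtain ⟨x, hx⟩ := (h (y - y')).1 (by rw [map_sub, e, sub_self])
    refine (Submodule.Quotient.eq _).2 ⟨btmul R m x, ?_⟩
    rw [btmap_btmul, hx, eq_sub_iff_add_eq, ← btmul_add, sub_add_cancel]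
  have hs : ∀ z, g (Function.surjInv hg z) = z := Function.surjInv_eq hg
  refine ⟨btlift (fun m z => (LinearMap.range (btmap R M f)).mkQ
      (btmul R m (Function.surjInv hg z)))
    (fun m n z => by rw [add_btmul, map_add])
    (fun m z w => by rw [← map_add, ← btmul_add]; exact mkQ_eq _ _ _ (by simp only [map_add, hs]))
    (fun r m z => by rw [smul_btmul, map_smul])
    (fun r m z => by rw [op_smul_btmul]; exact mkQ_eq _ _ _ (by simp only [map_smul, hs])), ?_⟩
  exact btensor_hom_ext fun m y => mkQ_eq _ _ _ (hs _)

theorem btmap_exact {f : X →ₗ[R] Y} {g : Y →ₗ[R] Z} (h : Function.Exact f g)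
    (hg : Function.Surjective g) : Function.Exact (btmap R M f) (btmap R M g) := by
  obtain ⟨φ, hφ⟩ := exists_comp_btmap_eq_mkQ R M h hg
  refine LinearMap.exact_of_comp_of_mem_range ?_ fun t ht => ?_
  · rw [← btmap_comp, h.linearMap_comp_eq_zero, btmap_zero]
  · rw [← Submodule.ker_mkQ (LinearMap.range (btmap R M f)), LinearMap.mem_ker, ← hφ,
      LinearMap.comp_apply, ht, map_zero]

end BalancedTensor

/-! ### Vanishing of `Tor₁` and `Ext¹` -/

section TorVanish

variable (R : Type u) [Ring R]
variable (M : Type u) [AddCommGroup M] [Module R M] [Module Rᵐᵒᵖ M]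

/-- `Tor₁^R(M, X) = 0`, in the form: `M ⊗_R -` keeps every short exact sequence that ends in `X`
exact. -/
def TorVanish (X : Type u) [AddCommGroup X] [Module R X] : Prop :=
  ∀ ⦃K L : Type u⦄ [AddCommGroup K] [Module R K] [AddCommGroup L] [Module R L]
    (i : K →ₗ[R] L) (p : L →ₗ[R] X), IsShortExact i p → Function.Injective (btmap R M i)

variable {R M} {X Y Z : Type u} [AddCommGroup X] [Module R X] [AddCommGroup Y] [Module R Y]
  [AddCommGroup Z] [Module R Z]

theorem torVanish_of_projective {K₀ P : Type u} [AddCommGroup K₀] [Module R K₀]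
    [AddCommGroup P] [Module R P] [Module.Projective R P] {i₀ : K₀ →ₗ[R] P} {p₀ : P →ₗ[R] X}
    (h₀ : IsShortExact i₀ p₀) (hM : Function.Injective (btmap R M i₀)) : TorVanish R M X := by
  intro K L _ _ _ _ i p h
  obtain ⟨φ, hφ⟩ := Module.projective_lifting_property p p₀ h.surjective
  obtain ⟨ψ, hσ⟩ := exists_isShortExact_prod h₀ h φ hφ
  rw [injective_iff_map_eq_zero]
  intro t ht
  obtain ⟨w, hw⟩ := (btmap_exact R M hσ.exact hσ.surjective (btmap R M (.inr R P K) t)).1 <| by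
    rw [← LinearMap.comp_apply, ← btmap_comp, LinearMap.coprod_inr, ht]
  have hw_zero : w = 0 := hM <| by
    have := congrArg (btmap R M (.fst R P K)) hw
    rwa [← LinearMap.comp_apply, ← LinearMap.comp_apply, ← btmap_comp, ← btmap_comp,
      LinearMap.fst_prod, LinearMap.fst_comp_inr, btmap_zero, LinearMap.zero_apply,
      ← map_zero (btmap R M i₀)] at this
  rw [← btmap_leftInverse R M (g := .snd R P K) (f := .inr R P K) (fun _ => rfl) t, ← hw,
    hw_zero, map_zero, map_zero]

theorem torVanish_of_subsingleton_tor {X : ModuleCat.{u} R} (h : Subsingleton (Tor R M 1 X)) :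
    TorVanish R M X := by
  let P := ProjectiveResolution.of X
  have hacyclic : (((tensorFunctor R M).mapHomologicalComplex _).obj P.complex).ExactAt 1 := by
    rw [HomologicalComplex.exactAt_iff_isZero_homology]
    exact (ModuleCat.isZero_of_subsingleton (Tor R M 1 X)).of_iso
      (P.isoLeftDerivedObj (tensorFunctor R M) 1).symm
  rw [HomologicalComplex.exactAt_iff' _ 2 1 0 (by simp) (by simp),
    ShortComplex.moduleCat_exact_iff] at hacyclic
  let p : P.complex.X 0 →ₗ[R] X := (P.π.f 0).hom
  have hdp : Function.Exact (P.complex.d 1 0).hom p :=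
    (ShortComplex.ShortExact.moduleCat_exact_iff_function_exact _).1 P.exact₀
  have hp : Function.Surjective p := (ModuleCat.epi_iff_surjective (P.π.f 0)).1 inferInstance
  have : Module.Projective R (P.complex.X 0) := (IsProjective.iff_projective _).2 (P.projective 0)
  have hker := isShortExact_subtype_ker hp
  refine torVanish_of_projective hker ?_
  obtain ⟨c, hc⟩ := exists_lift_of_exact hker.exact hker.injective (P.complex.d 1 0).hom
    hdp.linearMap_comp_eq_zero
  have hc_surj : Function.Surjective c := fun x => by
    obtain ⟨y, hy⟩ := (hdp x).1 x.2
    exact ⟨y, hker.injective ((LinearMap.congr_fun hc y).trans hy)⟩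
  have hcd : c ∘ₗ (P.complex.d 2 1).hom = 0 := by
    rw [← LinearMap.cancel_left hker.injective, ← LinearMap.comp_assoc, hc, LinearMap.comp_zero]
    exact congrArg ModuleCat.Hom.hom (P.complex.d_comp_d 2 1 0)
  rw [injective_iff_map_eq_zero]
  intro t ht
  obtain ⟨t, rfl⟩ := btmap_surjective R M hc_surj t
  rw [← LinearMap.comp_apply, ← btmap_comp, hc] at ht
  obtain ⟨s, rfl⟩ : ∃ s : BTensor R M (P.complex.X 2), btmap R M (P.complex.d 2 1).hom s = t :=
    hacyclic t ht
  rw [← LinearMap.comp_apply, ← btmap_comp, hcd, btmap_zero, LinearMap.zero_apply]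

theorem TorVanish.of_isShortExact {i : X →ₗ[R] Y} {p : Y →ₗ[R] Z} (h : IsShortExact i p)
    (hX : TorVanish R M X) (hZ : TorVanish R M Z) : TorVanish R M Y := by
  intro K L _ _ _ _ j q hj
  obtain ⟨j', q', hj', rfl⟩ := exists_isShortExact_ker_comp h hj
  rw [btmap_comp]
  have hpq : Function.Surjective (p ∘ₗ q) := h.surjective.comp hj.surjective
  exact (hZ _ _ (isShortExact_subtype_ker hpq)).comp (hX j' q' hj')

theorem TorVanish.of_subsingleton [Subsingleton X] : TorVanish R M X := by
  intro K L _ _ _ _ i p h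
  let e := LinearEquiv.ofBijective i ⟨h.injective, fun l => (h.exact l).1 (Subsingleton.elim _ _)⟩
  exact (btmap_leftInverse R M (g := e.symm.toLinearMap) (f := i) e.symm_apply_apply).injective

theorem TorVanish.of_equiv (hX : TorVanish R M X) (e : X ≃ₗ[R] Y) : TorVanish R M Y :=
  fun _ _ _ _ _ _ i p h => hX i (e.symm.toLinearMap ∘ₗ p)
    ⟨h.injective, LinearEquiv.postcomp_exact_iff_exact.2 h.exact,
      e.symm.surjective.comp h.surjective⟩

end TorVanish

section ExtVanish

variable {A : Type u} [Ring A] {W X Y Z : Type u} [AddCommGroup W] [Module A W]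
  [AddCommGroup X] [Module A X] [AddCommGroup Y] [Module A Y] [AddCommGroup Z] [Module A Z]

variable (A X Y) in
/-- `Ext¹_A(X, Y) = 0`. -/
abbrev ExtVanish : Prop :=
  Subsingleton (Abelian.Ext (ModuleCat.of A X) (ModuleCat.of A Y) 1)

theorem IsShortExact.shortExact {i : X →ₗ[A] Y} {p : Y →ₗ[A] Z} (h : IsShortExact i p) :
    (ShortComplex.moduleCatMk i p h.exact.linearMap_comp_eq_zero).ShortExact where
  exact := (ShortComplex.ShortExact.moduleCat_exact_iff_function_exact _).2 h.exact
  mono_f := (ModuleCat.mono_iff_injective _).2 h.injective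
  epi_g := (ModuleCat.epi_iff_surjective _).2 h.surjective

theorem ExtVanish.exists_extension (hExt : ExtVanish A Z W) {i : X →ₗ[A] Y} {p : Y →ₗ[A] Z}
    (h : IsShortExact i p) (f : X →ₗ[A] W) : ∃ g : Y →ₗ[A] W, g ∘ₗ i = f := by
  obtain ⟨x, hx⟩ := Abelian.Ext.contravariant_sequence_exact₁ h.shortExact _
    (Abelian.Ext.mk₀ (ModuleCat.ofHom f)) (zero_add 1) (hExt.elim _ _)
  obtain ⟨g, rfl⟩ := (Abelian.Ext.mk₀_bijective _ _).2 x
  rw [Abelian.Ext.mk₀_comp_mk₀] at hx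
  exact ⟨g.hom, congrArg ModuleCat.Hom.hom ((Abelian.Ext.mk₀_bijective _ _).1 hx)⟩

theorem ExtVanish.exists_lift (hExt : ExtVanish A W X) {i : X →ₗ[A] Y} {p : Y →ₗ[A] Z}
    (h : IsShortExact i p) (f : W →ₗ[A] Z) : ∃ g : W →ₗ[A] Y, p ∘ₗ g = f := by
  obtain ⟨x, hx⟩ := Abelian.Ext.covariant_sequence_exact₃ _ h.shortExact
    (Abelian.Ext.mk₀ (ModuleCat.ofHom f)) (zero_add 1) (hExt.elim _ _)
  obtain ⟨g, rfl⟩ := (Abelian.Ext.mk₀_bijective _ _).2 x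
  rw [Abelian.Ext.mk₀_comp_mk₀] at hx
  exact ⟨g.hom, congrArg ModuleCat.Hom.hom ((Abelian.Ext.mk₀_bijective _ _).1 hx)⟩

theorem ExtVanish.of_isShortExact {i : X →ₗ[A] Y} {p : Y →ₗ[A] Z} (h : IsShortExact i p)
    (hX : ExtVanish A W X) (hZ : ExtVanish A W Z) : ExtVanish A W Y := by
  refine subsingleton_of_forall_eq 0 fun x => ?_
  obtain ⟨y, rfl⟩ := Abelian.Ext.covariant_sequence_exact₂ _ h.shortExact x (hZ.elim _ _)
  obtain rfl : y = 0 := hX.elim _ _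
  exact Abelian.Ext.zero_comp _ _ (Abelian.Ext.mk₀ (ModuleCat.ofHom i)) _ (add_zero 1)

theorem ExtVanish.of_subsingleton [Subsingleton Y] : ExtVanish A X Y := by
  refine subsingleton_of_forall_eq 0 fun x => ?_
  rw [← x.comp_mk₀_id, (ModuleCat.isZero_of_subsingleton (ModuleCat.of A Y)).eq_of_src (𝟙 _) 0,
    Abelian.Ext.mk₀_zero, Abelian.Ext.comp_zero]

theorem ExtVanish.of_leftInverse (hY : ExtVanish A W Y) {r : Y →ₗ[A] X} {s : X →ₗ[A] Y}
    (h : Function.LeftInverse r s) : ExtVanish A W X := by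
  refine subsingleton_of_forall_eq 0 fun x => ?_
  have hrs : ModuleCat.ofHom s ≫ ModuleCat.ofHom r = 𝟙 (ModuleCat.of A X) := by ext y; exact h y
  rw [← x.comp_mk₀_id, ← hrs, ← Abelian.Ext.mk₀_comp_mk₀,
    ← Abelian.Ext.comp_assoc_of_second_deg_zero,
    hY.elim (x.comp (Abelian.Ext.mk₀ (ModuleCat.ofHom s)) (add_zero 1)) 0, Abelian.Ext.zero_comp]

theorem extVanish_of_exists_extension [Module.Projective A Y] {i : X →ₗ[A] Y} {p : Y →ₗ[A] Z}
    (h : IsShortExact i p) (hext : ∀ f : X →ₗ[A] W, ∃ g : Y →ₗ[A] W, g ∘ₗ i = f) :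
    ExtVanish A Z W := by
  refine subsingleton_of_forall_eq 0 fun x => ?_
  have : ExtVanish A Y W :=
    have : Projective (ModuleCat.of A Y) := (IsProjective.iff_projective Y).1 inferInstance
    Abelian.Ext.subsingleton_of_projective _ _ 0
  obtain ⟨y, rfl⟩ := Abelian.Ext.contravariant_sequence_exact₃ h.shortExact _ x
    (this.elim _ _) (add_zero 1)
  obtain ⟨f, rfl⟩ := (Abelian.Ext.mk₀_bijective _ _).2 y
  obtain ⟨g, hg⟩ := hext f.hom
  obtain rfl : ModuleCat.ofHom i ≫ ModuleCat.ofHom g = f := ModuleCat.hom_ext hg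
  exact (congrArg (h.shortExact.extClass.comp · (add_zero 1))
    (Abelian.Ext.mk₀_comp_mk₀ (ModuleCat.ofHom i) (ModuleCat.ofHom g)).symm).trans
      (h.shortExact.extClass_comp_assoc (Abelian.Ext.mk₀ (ModuleCat.ofHom g)))

end ExtVanish

/-! ### Gorenstein projective modules -/

section Gorenstein

theorem exists_int_sequence {α : Type*} (r : α → α → Prop) (next : ∀ a, ∃ b, r a b)
    (prev : ∀ a, ∃ b, r b a) (a : α) : ∃ z : ℤ → α, z 0 = a ∧ ∀ n, r (z n) (z (n + 1)) := by
  choose next hnext using next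
  choose prev hprev using prev
  refine ⟨fun | .ofNat n => next^[n] a | .negSucc n => prev^[n + 1] a, rfl, ?_⟩
  rintro (n | _ | n)
  · change r (next^[n] a) (next^[n + 1] a)
    rw [Function.iterate_succ_apply']
    exact hnext _
  · exact hprev a
  · change r (prev^[n + 1 + 1] a) (prev^[n + 1] a)
    rw [Function.iterate_succ_apply' _ (n + 1)]
    exact hprev _

variable {A : Type u} [Ring A]

/-- `V` is a cosyzygy of `W`: there is a short exact sequence `0 → W → Q → V → 0` with `Q`
projective that `Hom(-, P)` keeps exact for every projective `P`. -/
def IsCosyzygy (W V : ModuleCat.{u} A) : Prop :=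
  ∃ (Q : ModuleCat.{u} A) (i : W →ₗ[A] Q) (p : Q →ₗ[A] V), Module.Projective A Q ∧
    IsShortExact i p ∧ ∀ P : ModuleCat.{u} A, Module.Projective A P → ∀ f : W →ₗ[A] P,
      ∃ g : Q →ₗ[A] P, g ∘ₗ i = f

theorem IsCosyzygy.congr {W V W' V' : ModuleCat.{u} A} (h : IsCosyzygy W V) (e : W' ≃ₗ[A] W)
    (e' : V ≃ₗ[A] V') : IsCosyzygy W' V' := by
  obtain ⟨Q, i, p, hQ, hip, hext⟩ := h
  refine ⟨Q, i ∘ₗ e.toLinearMap, e'.toLinearMap ∘ₗ p, hQ,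
    hip.congr e (LinearEquiv.refl A Q) e', fun P hP f => ?_⟩
  obtain ⟨g, hg⟩ := hext P hP (f ∘ₗ e.symm.toLinearMap)
  refine ⟨g, ?_⟩
  rw [← LinearMap.comp_assoc, hg, LinearMap.comp_assoc, LinearEquiv.symm_comp, LinearMap.comp_id]

namespace CompleteProjectiveResolution

/-- The complete projective resolution that is spliced together from short exact sequences
`0 → W n → Q n → W (n + 1) → 0`. -/
def splice {W Q : ℤ → ModuleCat.{u} A} (i : ∀ n, W n →ₗ[A] Q n) (p : ∀ n, Q n →ₗ[A] W (n + 1))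
    (hQ : ∀ n, Module.Projective A (Q n)) (h : ∀ n, IsShortExact (i n) (p n))
    (hext : ∀ n, ∀ P : ModuleCat.{u} A, Module.Projective A P → ∀ f : W n →ₗ[A] P,
      ∃ g : Q n →ₗ[A] P, g ∘ₗ i n = f) : CompleteProjectiveResolution A where
  X := Q
  d n := i (n + 1) ∘ₗ p n
  projective := hQ
  exact n := by
    rw [(h n).surjective.comp_exact_iff_exact, (h (n + 1 + 1)).injective.comp_exact_iff_exact]
    exact (h (n + 1)).exact
  hom_exact P hP n f := by
    constructor
    · intro hf
      obtain ⟨g, rfl⟩ := exists_desc_of_exact (h (n + 1)).exact (h (n + 1)).surjective f <| by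
        rwa [← LinearMap.cancel_right (h n).surjective]
      obtain ⟨k, rfl⟩ := hext (n + 1 + 1) P hP g
      exact ⟨k, rfl⟩
    · rintro ⟨k, rfl⟩
      ext x
      simp [(h (n + 1)).exact.apply_apply_eq_zero]

variable (Q : CompleteProjectiveResolution A)

/-- The map to the next kernel that the differential induces. -/
def toKer (n : ℤ) : Q.X n →ₗ[A] LinearMap.ker (Q.d (n + 1)) :=
  (Q.d n).codRestrict _ fun x => LinearMap.mem_ker.2 ((Q.exact n).apply_apply_eq_zero x)

theorem isShortExact_toKer (n : ℤ) :
    IsShortExact (LinearMap.ker (Q.d n)).subtype (Q.toKer n) where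
  injective := Submodule.subtype_injective _
  exact := by
    rw [LinearMap.exact_iff, toKer, LinearMap.ker_codRestrict, Submodule.range_subtype]
  surjective x := by
    obtain ⟨y, hy⟩ := (Q.exact n x).1 x.2
    exact ⟨y, Subtype.ext hy⟩

/-- The complex `Hom(Q, Y)` is exact. (That its differentials compose to zero is automatic.) -/
def IsHomExact (Y : Type*) [AddCommGroup Y] [Module A Y] : Prop :=
  ∀ n, ∀ f : Q.X (n + 1) →ₗ[A] Y, f ∘ₗ Q.d n = 0 →
    ∃ g : Q.X (n + 1 + 1) →ₗ[A] Y, g ∘ₗ Q.d (n + 1) = f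

variable {Q} {X Y Z : Type*} [AddCommGroup X] [Module A X] [AddCommGroup Y] [Module A Y]
  [AddCommGroup Z] [Module A Z]

theorem IsHomExact.exists_extension (hY : Q.IsHomExact Y) (n : ℤ)
    (f : LinearMap.ker (Q.d n) →ₗ[A] Y) :
    ∃ g : Q.X n →ₗ[A] Y, g ∘ₗ (LinearMap.ker (Q.d n)).subtype = f := by
  obtain ⟨k, rfl⟩ : ∃ k, n = k + 1 + 1 := ⟨n - 2, by lia⟩
  obtain ⟨g, hg⟩ := hY k (f ∘ₗ Q.toKer (k + 1)) <| by
    rw [LinearMap.comp_assoc, show Q.toKer (k + 1) ∘ₗ Q.d k = 0 from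
      LinearMap.ext fun x => Subtype.ext ((Q.exact k).apply_apply_eq_zero x), LinearMap.comp_zero]
  exact ⟨g, (LinearMap.cancel_right (Q.isShortExact_toKer (k + 1)).surjective).1 hg⟩

theorem IsHomExact.of_isShortExact {i : X →ₗ[A] Y} {p : Y →ₗ[A] Z} (h : IsShortExact i p)
    (hX : Q.IsHomExact X) (hY : Q.IsHomExact Y) : Q.IsHomExact Z := by
  intro n f hf
  obtain ⟨k, rfl⟩ : ∃ k, n = k + 1 := ⟨n - 1, by lia⟩
  have := Q.projective (k + 1 + 1)
  obtain ⟨f', rfl⟩ := Module.projective_lifting_property p f h.surjective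
  obtain ⟨g, hg⟩ := exists_lift_of_exact h.exact h.injective (f' ∘ₗ Q.d (k + 1)) hf
  obtain ⟨g, rfl⟩ := hX k g <| by
    rw [← LinearMap.cancel_left h.injective, ← LinearMap.comp_assoc, hg, LinearMap.comp_assoc,
      (Q.exact k).linearMap_comp_eq_zero, LinearMap.comp_zero, LinearMap.comp_zero]
  obtain ⟨l, hl⟩ := hY (k + 1) (f' - i ∘ₗ g) <| by
    rw [LinearMap.sub_comp, LinearMap.comp_assoc, hg, sub_self]
  refine ⟨p ∘ₗ l, ?_⟩
  rw [LinearMap.comp_assoc, hl, LinearMap.comp_sub, ← LinearMap.comp_assoc,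
    h.exact.linearMap_comp_eq_zero, LinearMap.zero_comp, sub_zero]

theorem isHomExact_of_projective (P : ModuleCat.{u} A) [hP : Module.Projective A P] :
    Q.IsHomExact P :=
  fun n f => (Q.hom_exact P hP n f).1

variable (Q) in
theorem isCosyzygy_ker (n : ℤ) : IsCosyzygy (ModuleCat.of A (LinearMap.ker (Q.d n)))
    (ModuleCat.of A (LinearMap.ker (Q.d (n + 1)))) :=
  ⟨Q.X n, _, Q.toKer n, Q.projective n, Q.isShortExact_toKer n,
    fun P _ => (isHomExact_of_projective P).exists_extension n⟩

end CompleteProjectiveResolution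

open CompleteProjectiveResolution in
theorem gp_iff_exists_isCosyzygy {G : ModuleCat.{u} A} :
    GP A G ↔ ∃ W : ℤ → ModuleCat.{u} A, Nonempty (G ≃ₗ[A] W 0) ∧
      ∀ n, IsCosyzygy (W n) (W (n + 1)) := by
  constructor
  · rintro ⟨Q, hQ⟩
    exact ⟨fun n => ModuleCat.of A (LinearMap.ker (Q.d n)), hQ, Q.isCosyzygy_ker⟩
  · rintro ⟨W, ⟨e⟩, hW⟩
    choose Q i p hQ hip hext using hW
    refine ⟨splice i p hQ hip hext, ⟨e ≪≫ₗ LinearEquiv.ofInjective (i 0) (hip 0).injective ≪≫ₗ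
      LinearEquiv.ofEq _ _ ?_⟩⟩
    rw [← (hip 0).exact.linearMap_ker_eq]
    exact (LinearMap.ker_comp_of_ker_eq_bot _
      (LinearMap.ker_eq_bot.2 (hip (0 + 1)).injective)).symm

theorem GP.of_equiv {G G' : ModuleCat.{u} A} (h : GP A G) (e : G ≃ₗ[A] G') : GP A G' :=
  let ⟨Q, ⟨e'⟩⟩ := h; ⟨Q, ⟨e.symm ≪≫ₗ e'⟩⟩

theorem GP.exists_cosyzygy {G : ModuleCat.{u} A} (h : GP A G) :
    ∃ G', GP A G' ∧ IsCosyzygy G G' := by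
  obtain ⟨W, ⟨e⟩, hW⟩ := gp_iff_exists_isCosyzygy.1 h
  exact ⟨W 1, gp_iff_exists_isCosyzygy.2
    ⟨fun n => W (n + 1), ⟨LinearEquiv.refl A _⟩, fun n => hW (n + 1)⟩,
    (hW 0).congr e (LinearEquiv.refl A _)⟩

theorem GP.exists_syzygy {G : ModuleCat.{u} A} (h : GP A G) :
    ∃ G', GP A G' ∧ IsCosyzygy G' G := by
  obtain ⟨W, ⟨e⟩, hW⟩ := gp_iff_exists_isCosyzygy.1 h
  exact ⟨W (-1), gp_iff_exists_isCosyzygy.2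
    ⟨fun n => W (n - 1), ⟨LinearEquiv.refl A _⟩, fun n => by simpa using hW (n - 1)⟩,
    (hW (-1)).congr (LinearEquiv.refl A _) e.symm⟩

theorem le_gp_of_exists_isCosyzygy {𝒲 : ObjectProperty (ModuleCat.{u} A)}
    (next : ∀ W, 𝒲 W → ∃ V, 𝒲 V ∧ IsCosyzygy W V) (prev : ∀ W, 𝒲 W → ∃ V, 𝒲 V ∧ IsCosyzygy V W) :
    𝒲 ≤ GP A := by
  intro G hG
  obtain ⟨W, hW₀, hW⟩ := exists_int_sequence (α := {W // 𝒲 W}) (fun W V => IsCosyzygy W.1 V.1)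
    (fun W => let ⟨V, hV, h⟩ := next W.1 W.2; ⟨⟨V, hV⟩, h⟩)
    (fun W => let ⟨V, hV, h⟩ := prev W.1 W.2; ⟨⟨V, hV⟩, h⟩) ⟨G, hG⟩
  refine gp_iff_exists_isCosyzygy.2 ⟨fun n => (W n).1, ?_, hW⟩
  beta_reduce
  rw [hW₀]
  exact ⟨LinearEquiv.refl A G⟩

end Gorenstein

/-! ### Tensor powers -/

section TensorPowers

variable (R : Type u) [Ring R]
variable (M : Type u) [AddCommGroup M] [Module R M] [Module Rᵐᵒᵖ M]

instance (X : Type u) [AddCommGroup X] [Module R X] [Subsingleton X] :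
    Subsingleton (BTensor R M X) :=
  subsingleton_of_forall_eq 0 fun t => by
    rw [← LinearMap.id_apply (R := R) t, ← btmap_id R M,
      Subsingleton.elim (LinearMap.id : X →ₗ[R] X) 0, btmap_zero, LinearMap.zero_apply]

/-- `M^{⊗ i} ⊗_R X` for an unbundled module `X`. -/
abbrev TensorPow (i : ℕ) (X : Type u) [AddCommGroup X] [Module R X] : Type u :=
  tensorPow R M i (ModuleCat.of R X)

variable {X Y Z : Type u} [AddCommGroup X] [Module R X] [AddCommGroup Y] [Module R Y]
  [AddCommGroup Z] [Module R Z]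

/-- The functoriality `M^{⊗ i} ⊗_R f` of the tensor powers. -/
def tensorPowMap (f : X →ₗ[R] Y) : (i : ℕ) → TensorPow R M i X →ₗ[R] TensorPow R M i Y
  | 0 => f
  | i + 1 => btmap R M (tensorPowMap f i)

theorem tensorPowMap_comp (g : Y →ₗ[R] Z) (f : X →ₗ[R] Y) (i : ℕ) :
    tensorPowMap R M (g ∘ₗ f) i = tensorPowMap R M g i ∘ₗ tensorPowMap R M f i := by
  induction i with
  | zero => rfl
  | succ i ih => exact (congrArg (btmap R M) ih).trans (btmap_comp R M _ _)

theorem tensorPowMap_leftInverse {g : Y →ₗ[R] X} {f : X →ₗ[R] Y} (h : Function.LeftInverse g f)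
    (i : ℕ) : Function.LeftInverse (tensorPowMap R M g i) (tensorPowMap R M f i) := by
  induction i with
  | zero => exact h
  | succ i ih => exact btmap_leftInverse R M ih

variable {R} in
theorem tensorPowMap_surjective {f : X →ₗ[R] Y} (hf : Function.Surjective f) (i : ℕ) :
    Function.Surjective (tensorPowMap R M f i) := by
  induction i with
  | zero => exact hf
  | succ i ih => exact btmap_surjective R M ih

variable {R} in
theorem tensorPowMap_exact {f : X →ₗ[R] Y} {g : Y →ₗ[R] Z} (h : Function.Exact f g)
    (hg : Function.Surjective g) (i : ℕ) :
    Function.Exact (tensorPowMap R M f i) (tensorPowMap R M g i) := by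
  induction i with
  | zero => exact h
  | succ i ih => exact btmap_exact R M ih (tensorPowMap_surjective M hg i)

variable {R M} in
theorem tensorPowMap_isShortExact {f : X →ₗ[R] Y} {g : Y →ₗ[R] Z} (h : IsShortExact f g)
    (hZ : ∀ i, TorVanish R M (TensorPow R M i Z)) (i : ℕ) :
    IsShortExact (tensorPowMap R M f i) (tensorPowMap R M g i) where
  injective := by
    induction i with
    | zero => exact h.injective
    | succ i ih =>
      exact hZ i _ _ ⟨ih, tensorPowMap_exact M h.exact h.surjective i,
        tensorPowMap_surjective M h.surjective i⟩
  exact := tensorPowMap_exact M h.exact h.surjective i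
  surjective := tensorPowMap_surjective M h.surjective i

variable (X) in
/-- The isomorphism `M^{⊗ i} ⊗_R (M ⊗_R X) ≅ M ⊗_R (M^{⊗ i} ⊗_R X)`. -/
def tensorPowComm : (i : ℕ) → TensorPow R M i (BTensor R M X) ≃ₗ[R] BTensor R M (TensorPow R M i X)
  | 0 => LinearEquiv.refl R _
  | i + 1 => btensorCongr R M (tensorPowComm i)

theorem tensorPowComm_comp_tensorPowMap_btmap (f : X →ₗ[R] Y) (i : ℕ) :
    (tensorPowComm R M Y i).toLinearMap ∘ₗ tensorPowMap R M (btmap R M f) i =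
      btmap R M (tensorPowMap R M f i) ∘ₗ (tensorPowComm R M X i).toLinearMap := by
  induction i with
  | zero => rfl
  | succ i ih =>
    exact (btmap_comp R M _ _).symm.trans ((congrArg (btmap R M) ih).trans (btmap_comp R M _ _))

theorem iSup_range_tensorPowMap_toSpanSingleton (i : ℕ) :
    ⨆ x : X, LinearMap.range (tensorPowMap R M (LinearMap.toSpanSingleton R X x) i) = ⊤ := by
  refine Submodule.eq_top_iff'.2 fun y => ?_
  induction i with
  | zero => exact Submodule.mem_iSup_of_mem y ⟨(1 : R), one_smul R (y : X)⟩
  | succ i ih =>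
    induction y using btensor_induction (X := TensorPow R M i X) with
    | zero => exact zero_mem _
    | tmul m y =>
      induction ih y using Submodule.iSup_induction' with
      | mem x y hy =>
        obtain ⟨z, rfl⟩ := hy
        exact Submodule.mem_iSup_of_mem x ⟨consTensor R M i m z, rfl⟩
      | zero => rw [btmul_zero]; exact zero_mem _
      | add y z _ _ hy hz => rw [btmul_add]; exact add_mem hy hz
    | add s t hs ht => exact add_mem hs ht

variable {R M}

theorem tensorPow_subsingleton {i : ℕ} (h : Subsingleton (TensorPow R M i R)) :
    Subsingleton (TensorPow R M i X) := by
  rw [← Submodule.subsingleton_iff R, ← subsingleton_iff_bot_eq_top,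
    ← iSup_range_tensorPowMap_toSpanSingleton, eq_comm, iSup_eq_bot]
  exact fun x => LinearMap.range_eq_bot.2 <| LinearMap.ext fun z => by
    rw [Subsingleton.elim z 0, map_zero, map_zero]

theorem tensorPow_subsingleton_of_le {i j : ℕ} (hij : i ≤ j)
    (h : Subsingleton (TensorPow R M i X)) : Subsingleton (TensorPow R M j X) := by
  induction j, hij using Nat.le_induction with
  | base => exact h
  | succ j _ ih => exact inferInstanceAs (Subsingleton (BTensor R M (TensorPow R M j X)))

theorem IsNilpotentBimodule.induction {N : ℕ} (hN : IsNilpotentBimodule R M N) {p : ℕ → Prop}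
    (vanish : ∀ i, (∀ (X : Type u) [AddCommGroup X] [Module R X],
      Subsingleton (TensorPow R M i X)) → p i)
    (step : ∀ i, p (i + 1) → p i) (i : ℕ) : p i := by
  refine Nat.decreasingInduction (motive := fun i _ => p i) (fun j _ => step j)
    (vanish (max i (N + 1)) fun X _ _ => ?_) (le_max_left i (N + 1))
  exact tensorPow_subsingleton_of_le (le_max_right i (N + 1)) (tensorPow_subsingleton hN)

end TensorPowers

/-! ### Modules over the tensor ring -/

section TensorRingModules

variable (R : Type u) [Ring R]
variable (M : Type u) [AddCommGroup M] [Module R M] [Module Rᵐᵒᵖ M]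

instance : IsScalarTower R (TensorRing R M) (TensorRing R M) where
  smul_assoc r s t := by
    rw [smul_eq_mul, smul_eq_mul, ← base_mul, ← base_mul, mul_assoc]

theorem cons_eq_mul (m : M) (t : TensorRing R M) :
    TensorRing.cons R M (btmul R m t) = bimoduleIncl R M m * t := by
  rw [bimoduleIncl, cons_mul, one_mul]

variable {X Y : Type u} [AddCommGroup X] [Module R X] [Module (TensorRing R M) X]
  [IsScalarTower R (TensorRing R M) X] [AddCommGroup Y] [Module R Y] [Module (TensorRing R M) Y]
  [IsScalarTower R (TensorRing R M) Y]

theorem baseHom_smul (r : R) (x : X) : baseHom R M r • x = r • x := by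
  have h : baseHom R M r = r • (1 : TensorRing R M) := (mul_one _).symm.trans (base_mul r 1)
  rw [h, smul_assoc, one_smul]

variable (X) in
/-- The structure map `M ⊗_R X → X`, `m ⊗ x ↦ m x`, of a `T_R(M)`-module `X` whose `R`-module
structure is given separately. -/
def mulMap : BTensor R M X →ₗ[R] X :=
  btlift (fun m x => bimoduleIncl R M m • x)
    (fun m n x => by rw [bimoduleIncl_add, add_smul])
    (fun m x y => smul_add _ _ _)
    (fun r m x => by rw [bimoduleIncl_smul, mul_smul, baseHom_smul])
    (fun r m x => by rw [bimoduleIncl_op_smul, mul_smul, baseHom_smul])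

theorem comp_mulMap (f : X →ₗ[TensorRing R M] Y) :
    f.restrictScalars R ∘ₗ mulMap R M X = mulMap R M Y ∘ₗ btmap R M (f.restrictScalars R) :=
  btensor_hom_ext fun m x => map_smul f (bimoduleIncl R M m) x

theorem map_mulMap (f : X →ₗ[TensorRing R M] Y) (t : BTensor R M X) :
    f (mulMap R M X t) = mulMap R M Y (btmap R M (f.restrictScalars R) t) :=
  LinearMap.congr_fun (comp_mulMap R M f) t

variable {R M} in
/-- An `R`-linear map that commutes with the structure maps, as a `T_R(M)`-linear map. -/
def homOfCommute (f : X →ₗ[R] Y) (h : f ∘ₗ mulMap R M X = mulMap R M Y ∘ₗ btmap R M f) :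
    X →ₗ[TensorRing R M] Y where
  toFun := f
  map_add' := map_add f
  map_smul' t x := by
    rw [RingHom.id_apply]
    induction t using TensorRing.induction with
    | base r =>
      exact (congrArg f (baseHom_smul R M r x)).trans
        ((map_smul f r x).trans (baseHom_smul R M r (f x)).symm)
    | cons m t ih =>
      have hm : f (bimoduleIncl R M m • t • x) = bimoduleIncl R M m • f (t • x) :=
        LinearMap.congr_fun h (btmul R m (t • x))
      rw [cons_eq_mul, mul_smul, mul_smul, hm, ih]
    | add s t hs ht => rw [add_smul, add_smul, map_add, hs, ht]

end TensorRingModules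

section Pairs

variable {R : Type u} [Ring R]
variable {M : Type u} [AddCommGroup M] [Module R M] [Module Rᵐᵒᵖ M]
variable {X : Type u} [AddCommGroup X] [Module R X]

/-- The `T_R(M)`-module that corresponds to a pair `(X, u)`, as a type synonym of `X` that
carries both its `R`-module and its `T_R(M)`-module structure. -/
def PairMod (_ : BTensor R M X →ₗ[R] X) : Type u := X

variable (u : BTensor R M X →ₗ[R] X)

instance : AddCommGroup (PairMod u) := inferInstanceAs (AddCommGroup X)

instance : Module R (PairMod u) := inferInstanceAs (Module R X)

instance : Module (TensorRing R M) (PairMod u) :=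
  letI : Module (TensorRing R M) X := Module.compHom X (actHom u)
  inferInstanceAs (Module (TensorRing R M) X)

instance : IsScalarTower R (TensorRing R M) (PairMod u) where
  smul_assoc r t x := congr($(map_smul (act u) r t) x)

theorem PairMod.mulMap_eq : mulMap R M (PairMod u) = u :=
  btensor_hom_ext fun m x =>
    (act_cons u m 1 x).trans (congrArg (fun y => u (btmul R m y)) (act_one u x))

end Pairs

/-! ### Induced modules -/

section Induced

variable (R : Type u) [Ring R]
variable (M : Type u) [AddCommGroup M] [Module R M] [Module Rᵐᵒᵖ M]
variable (P : Type u) [AddCommGroup P] [Module R P]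

/-- The `T_R(M)`-module `P` on which `M` acts as zero. -/
abbrev TrivMod : Type u := PairMod (0 : BTensor R M P →ₗ[R] P)

/-- The induced module `Ind(P)` of an unbundled module `P`. -/
abbrev IndMod : Type u := PairMod (indMap R M (ModuleCat.of R P))

/-- The summand `M^{⊗ i} ⊗_R P` of `Ind(P)`. -/
def indOf (i : ℕ) : TensorPow R M i P →ₗ[R] IndMod R M P :=
  DirectSum.lof R ℕ (fun i => TensorPow R M i P) i

/-- The summand `P` of `Ind(P)`. -/
def indBase : P →ₗ[R] IndMod R M P := indOf R M P 0

variable {R M P}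

theorem indOf_succ (i : ℕ) :
    indOf R M P (i + 1) = mulMap R M (IndMod R M P) ∘ₗ btmap R M (indOf R M P i) := by
  rw [PairMod.mulMap_eq]
  exact btensor_hom_ext fun m y => (shift_of R M (ModuleCat.of R P) m i y).symm

theorem indMod_subsingleton [Subsingleton P] : Subsingleton (IndMod R M P) :=
  have (i : ℕ) : Subsingleton (TensorPow R M i P) :=
    tensorPow_subsingleton_of_le i.zero_le (inferInstanceAs (Subsingleton P))
  inferInstanceAs (Subsingleton (DirectSum ℕ fun i => TensorPow R M i P))

theorem indMod_induction {p : IndMod R M P → Prop} (z : IndMod R M P) (zero : p 0)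
    (of : ∀ i y, p (indOf R M P i y)) (add : ∀ z w, p z → p w → p (z + w)) : p z :=
  DirectSum.induction_on z zero of add

section Elim

variable {Y : Type*} [AddCommGroup Y] [Module R Y]

theorem indMod_hom_ext {f g : IndMod R M P →ₗ[R] Y}
    (h : ∀ i, f ∘ₗ indOf R M P i = g ∘ₗ indOf R M P i) : f = g :=
  DirectSum.linearMap_ext R h

theorem indMod_hom_ext_of_mulMap {f g : IndMod R M P →ₗ[R] Y}
    (hbase : f ∘ₗ indBase R M P = g ∘ₗ indBase R M P)
    (hmul : f ∘ₗ mulMap R M (IndMod R M P) = g ∘ₗ mulMap R M (IndMod R M P)) : f = g :=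
  indMod_hom_ext fun
    | 0 => hbase
    | i + 1 => (congrArg (f ∘ₗ ·) (indOf_succ i)).trans
        ((congrArg (· ∘ₗ btmap R M (indOf R M P i)) hmul).trans
          (congrArg (g ∘ₗ ·) (indOf_succ i)).symm)

theorem btensor_indMod_hom_ext {f g : BTensor R M (IndMod R M P) →ₗ[R] Y}
    (h : ∀ i, f ∘ₗ btmap R M (indOf R M P i) = g ∘ₗ btmap R M (indOf R M P i)) : f = g := by
  refine btensor_hom_ext fun m z => ?_
  induction z using indMod_induction with
  | zero => rw [btmul_zero, map_zero, map_zero]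
  | of i y => exact LinearMap.congr_fun (h i) (btmul R m y)
  | add z w hz hw => rw [btmul_add, map_add, map_add, hz, hw]

/-- The linear map on `Ind(P)` with given restrictions to the summands. -/
def indElim (f : ∀ i, TensorPow R M i P →ₗ[R] Y) : IndMod R M P →ₗ[R] Y :=
  DirectSum.toModule R ℕ Y f

variable (f : ∀ i, TensorPow R M i P →ₗ[R] Y)

theorem indElim_comp_indOf (i : ℕ) : indElim f ∘ₗ indOf R M P i = f i :=
  LinearMap.ext fun y => DirectSum.toModule_lof (M := fun i => TensorPow R M i P) (φ := f) R i y

theorem indElim_comp_indBase : indElim f ∘ₗ indBase R M P = f 0 :=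
  indElim_comp_indOf f 0

theorem indElim_comp_mulMap_comp (i : ℕ) :
    (indElim f ∘ₗ mulMap R M (IndMod R M P)) ∘ₗ btmap R M (indOf R M P i) = f (i + 1) :=
  (congrArg (indElim f ∘ₗ ·) (indOf_succ i)).symm.trans (indElim_comp_indOf f (i + 1))

end Elim

section Lift

variable {Y : Type u} [AddCommGroup Y] [Module R Y] [Module (TensorRing R M) Y]
  [IsScalarTower R (TensorRing R M) Y]

/-- The map `M^{⊗ i} ⊗_R P → Y` that a linear map from `P` to a `T_R(M)`-module `Y` induces. -/
def powLift (φ : P →ₗ[R] Y) : (i : ℕ) → TensorPow R M i P →ₗ[R] Y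
  | 0 => φ
  | i + 1 => mulMap R M Y ∘ₗ btmap R M (powLift φ i)

theorem comp_indOf_eq_powLift (f : IndMod R M P →ₗ[TensorRing R M] Y) (i : ℕ) :
    f.restrictScalars R ∘ₗ indOf R M P i =
      powLift (f.restrictScalars R ∘ₗ indBase R M P) i := by
  induction i with
  | zero => rfl
  | succ i ih =>
    have : (f.restrictScalars R ∘ₗ mulMap R M (IndMod R M P)) ∘ₗ btmap R M (indOf R M P i) =
        mulMap R M Y ∘ₗ btmap R M (f.restrictScalars R ∘ₗ indOf R M P i) := by
      rw [comp_mulMap, LinearMap.comp_assoc, btmap_comp]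
    exact (congrArg (f.restrictScalars R ∘ₗ ·) (indOf_succ i)).trans
      (this.trans (congrArg (fun g => mulMap R M Y ∘ₗ btmap R M g) ih))

theorem ind_hom_ext {f g : IndMod R M P →ₗ[TensorRing R M] Y}
    (h : f.restrictScalars R ∘ₗ indBase R M P = g.restrictScalars R ∘ₗ indBase R M P) :
    f = g :=
  LinearMap.restrictScalars_injective R <| indMod_hom_ext fun i => by
    rw [comp_indOf_eq_powLift, comp_indOf_eq_powLift, h]

/-- The `T_R(M)`-linear extension `Ind(P) → Y` of a linear map `P → Y`. -/
def indLift (φ : P →ₗ[R] Y) : IndMod R M P →ₗ[TensorRing R M] Y :=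
  homOfCommute (indElim (powLift φ)) <| btensor_indMod_hom_ext fun i => by
    rw [indElim_comp_mulMap_comp, LinearMap.comp_assoc, ← btmap_comp, indElim_comp_indOf]
    rfl

theorem indLift_comp_indBase (φ : P →ₗ[R] Y) :
    (indLift φ).restrictScalars R ∘ₗ indBase R M P = φ :=
  indElim_comp_indBase _

end Lift

variable (R M P)

/-- The projection of `Ind(P)` to the summand `P`. -/
def indProj : IndMod R M P →ₗ[R] P :=
  indElim fun | 0 => LinearMap.id | _ + 1 => 0

theorem indProj_comp_indBase : indProj R M P ∘ₗ indBase R M P = LinearMap.id :=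
  indElim_comp_indBase _

theorem indProj_comp_mulMap : indProj R M P ∘ₗ mulMap R M (IndMod R M P) = 0 :=
  btensor_indMod_hom_ext fun i =>
    (indElim_comp_mulMap_comp _ i).trans (LinearMap.zero_comp _).symm

/-- The retraction of the structure map of `Ind(P)` that kills the summand `P`. -/
def indTail : IndMod R M P →ₗ[R] BTensor R M (IndMod R M P) :=
  indElim fun | 0 => 0 | i + 1 => btmap R M (indOf R M P i)

theorem indTail_comp_indBase : indTail R M P ∘ₗ indBase R M P = 0 :=
  indElim_comp_indBase _

theorem indTail_comp_mulMap :
    indTail R M P ∘ₗ mulMap R M (IndMod R M P) = LinearMap.id :=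
  btensor_indMod_hom_ext fun i =>
    (indElim_comp_mulMap_comp _ i).trans (LinearMap.id_comp _).symm

theorem isShortExact_mulMap_indProj :
    IsShortExact (mulMap R M (IndMod R M P)) (indProj R M P) := by
  refine isShortExact_of_split (indTail_comp_mulMap R M P) (indProj_comp_indBase R M P)
    (indProj_comp_mulMap R M P) (indMod_hom_ext_of_mulMap ?_ ?_)
  · rw [LinearMap.add_comp, LinearMap.comp_assoc, indTail_comp_indBase, LinearMap.comp_assoc,
      indProj_comp_indBase, LinearMap.comp_zero, zero_add, LinearMap.comp_id, LinearMap.id_comp]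
  · rw [LinearMap.add_comp, LinearMap.comp_assoc, indTail_comp_mulMap, LinearMap.comp_assoc,
      indProj_comp_mulMap, LinearMap.comp_zero, add_zero, LinearMap.comp_id, LinearMap.id_comp]

/-- The inclusion `Ind(M ⊗_R P) → Ind(P)` of the part of positive degree. -/
def indShift : IndMod R M (BTensor R M P) →ₗ[TensorRing R M] IndMod R M P :=
  indLift (mulMap R M (IndMod R M P) ∘ₗ btmap R M (indBase R M P))

theorem indShift_comp_indOf (i : ℕ) :
    (indShift R M P).restrictScalars R ∘ₗ indOf R M (BTensor R M P) i =
      mulMap R M (IndMod R M P) ∘ₗ btmap R M (indOf R M P i) ∘ₗ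
        (tensorPowComm R M P i).toLinearMap := by
  rw [comp_indOf_eq_powLift, indShift, indLift_comp_indBase]
  induction i with
  | zero => rfl
  | succ i ih =>
    rw [powLift, ih, ← LinearMap.comp_assoc]
    exact (congrArg (fun f : BTensor R M (TensorPow R M i P) →ₗ[R] IndMod R M P =>
      mulMap R M _ ∘ₗ btmap R M (f ∘ₗ (tensorPowComm R M P i).toLinearMap))
      (indOf_succ i)).symm.trans (congrArg (mulMap R M _ ∘ₗ ·) (btmap_comp R M _ _))

/-- The projection `Ind(P) → P`, as a `T_R(M)`-linear map to `P` with `M` acting as zero. -/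
def indAug : IndMod R M P →ₗ[TensorRing R M] TrivMod R M P :=
  let proj : IndMod R M P →ₗ[R] TrivMod R M P := indProj R M P
  homOfCommute proj <| (indProj_comp_mulMap R M P).trans <|
    (LinearMap.zero_comp (btmap R M proj)).symm.trans <|
      congrArg (· ∘ₗ btmap R M proj) (PairMod.mulMap_eq (0 : BTensor R M P →ₗ[R] P)).symm

theorem isShortExact_indShift_indAug : IsShortExact (indShift R M P) (indAug R M P) := by
  let shift : IndMod R M (BTensor R M P) →ₗ[R] IndMod R M P := (indShift R M P).restrictScalars R
  let unshift : IndMod R M P →ₗ[R] IndMod R M (BTensor R M P) :=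
    indElim fun
      | 0 => 0
      | i + 1 => indOf R M (BTensor R M P) i ∘ₗ (tensorPowComm R M P i).symm.toLinearMap
  have unshift_comp_indBase : unshift ∘ₗ indBase R M P = 0 := indElim_comp_indBase _
  have unshift_comp_mulMap_comp (i : ℕ) :
      (unshift ∘ₗ mulMap R M (IndMod R M P)) ∘ₗ btmap R M (indOf R M P i) =
        indOf R M (BTensor R M P) i ∘ₗ (tensorPowComm R M P i).symm.toLinearMap :=
    indElim_comp_mulMap_comp _ i
  have : IsShortExact shift (indProj R M P) := by
    refine isShortExact_of_split (r := unshift) (s := indBase R M P) (indMod_hom_ext fun i => ?_)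
      (indProj_comp_indBase R M P) (indMod_hom_ext fun i => ?_)
      (indMod_hom_ext_of_mulMap ?_ (btensor_indMod_hom_ext fun i => ?_))
    · rw [LinearMap.comp_assoc, indShift_comp_indOf, ← LinearMap.comp_assoc,
        ← LinearMap.comp_assoc, unshift_comp_mulMap_comp, LinearMap.comp_assoc,
        LinearEquiv.symm_comp, LinearMap.comp_id, LinearMap.id_comp]
    · rw [LinearMap.comp_assoc, indShift_comp_indOf, ← LinearMap.comp_assoc,
        indProj_comp_mulMap, LinearMap.zero_comp, LinearMap.zero_comp]
    · rw [LinearMap.add_comp, LinearMap.comp_assoc, unshift_comp_indBase, LinearMap.comp_assoc,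
        indProj_comp_indBase, LinearMap.comp_zero, zero_add, LinearMap.comp_id, LinearMap.id_comp]
    · rw [LinearMap.add_comp, LinearMap.comp_assoc _ (indProj R M P), indProj_comp_mulMap,
        LinearMap.comp_zero, add_zero, LinearMap.comp_assoc _ unshift, LinearMap.comp_assoc,
        unshift_comp_mulMap_comp, ← LinearMap.comp_assoc, indShift_comp_indOf,
        LinearMap.comp_assoc, LinearMap.comp_assoc, LinearEquiv.comp_symm, LinearMap.comp_id,
        LinearMap.id_comp]
  exact ⟨this.injective, fun z => this.exact z, this.surjective⟩

instance [Module.Projective R P] : Module.Projective (TensorRing R M) (IndMod R M P) := by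
  refine Module.Projective.of_lifting_property'' fun f hf => ?_
  obtain ⟨g, hg⟩ := Module.projective_lifting_property (f.restrictScalars R) (indBase R M P) hf
  refine ⟨indLift g, ind_hom_ext ?_⟩
  exact LinearMap.ext fun x =>
    (congrArg f (LinearMap.congr_fun (indLift_comp_indBase g) x)).trans (LinearMap.congr_fun hg x)

theorem exists_leftInverse_indMod (Q : Type u) [AddCommGroup Q] [Module R Q]
    [Module (TensorRing R M) Q] [IsScalarTower R (TensorRing R M) Q]
    [Module.Projective (TensorRing R M) Q] :
    ∃ (F : Type u) (_ : AddCommGroup F) (_ : Module R F) (s : Q →ₗ[TensorRing R M] IndMod R M F)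
      (r : IndMod R M F →ₗ[TensorRing R M] Q), Module.Projective R F ∧
        Function.LeftInverse r s := by
  let φ : (Q →₀ R) →ₗ[R] Q := Finsupp.linearCombination R id
  have hφ : Function.Surjective (indLift (M := M) φ) := fun x => by
    obtain ⟨y, rfl⟩ := Finsupp.linearCombination_id_surjective R Q x
    exact ⟨_, LinearMap.congr_fun (indLift_comp_indBase φ) y⟩
  obtain ⟨s, hs⟩ := Module.projective_lifting_property (indLift (M := M) φ)
    (LinearMap.id : Q →ₗ[TensorRing R M] Q) hφ
  exact ⟨Q →₀ R, inferInstance, inferInstance, s, indLift φ, inferInstance, LinearMap.congr_fun hs⟩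

end Induced

/-! ### The cokernel of the structure map -/

section Cokernel

variable (R : Type u) [Ring R]
variable (M : Type u) [AddCommGroup M] [Module R M] [Module Rᵐᵒᵖ M]
variable {X Y Z : Type u}
  [AddCommGroup X] [Module R X] [Module (TensorRing R M) X] [IsScalarTower R (TensorRing R M) X]
  [AddCommGroup Y] [Module R Y] [Module (TensorRing R M) Y] [IsScalarTower R (TensorRing R M) Y]
  [AddCommGroup Z] [Module R Z] [Module (TensorRing R M) Z] [IsScalarTower R (TensorRing R M) Z]

theorem btmap_restrictScalars_exact {f : X →ₗ[TensorRing R M] Y} {g : Y →ₗ[TensorRing R M] Z}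
    (h : Function.Exact f g) (hg : Function.Surjective g) :
    Function.Exact (btmap R M (f.restrictScalars R)) (btmap R M (g.restrictScalars R)) :=
  btmap_exact R M h hg

variable (X) in
/-- The cokernel `X / M X` of the structure map of a `T_R(M)`-module `X`. -/
abbrev Cok : Type u := X ⧸ LinearMap.range (mulMap R M X)

variable (X) in
/-- The projection `X → X / M X`. -/
def cokMk : X →ₗ[R] Cok R M X := (LinearMap.range (mulMap R M X)).mkQ

theorem cokMk_surjective : Function.Surjective (cokMk R M X) := Submodule.mkQ_surjective _

theorem exact_mulMap_cokMk : Function.Exact (mulMap R M X) (cokMk R M X) :=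
  fun _ => Submodule.Quotient.mk_eq_zero _

/-- The map `X / M X → Y / M Y` that a `T_R(M)`-linear map induces. -/
def cokMap (f : X →ₗ[TensorRing R M] Y) : Cok R M X →ₗ[R] Cok R M Y :=
  Submodule.mapQ _ _ (f.restrictScalars R) <| by
    rintro _ ⟨t, rfl⟩
    exact ⟨_, (map_mulMap R M f t).symm⟩

theorem cokMap_cokMk (f : X →ₗ[TensorRing R M] Y) (x : X) :
    cokMap R M f (cokMk R M X x) = cokMk R M Y (f x) := rfl

theorem cokMap_leftInverse {r : Y →ₗ[TensorRing R M] X} {s : X →ₗ[TensorRing R M] Y}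
    (h : Function.LeftInverse r s) : Function.LeftInverse (cokMap R M r) (cokMap R M s) :=
  (cokMk_surjective R M).forall.2 fun x => by rw [cokMap_cokMk, cokMap_cokMk, h]

/-- The isomorphism `X / M X ≅ Y / M Y` induced by `X ≅ Y`. -/
def cokCongr (e : X ≃ₗ[TensorRing R M] Y) : Cok R M X ≃ₗ[R] Cok R M Y :=
  { cokMap R M e.toLinearMap with
    invFun := cokMap R M e.symm.toLinearMap
    left_inv := cokMap_leftInverse R M e.symm_apply_apply
    right_inv := cokMap_leftInverse R M e.apply_symm_apply }

theorem cokMap_surjective {f : X →ₗ[TensorRing R M] Y} (hf : Function.Surjective f) :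
    Function.Surjective (cokMap R M f) :=
  Function.Surjective.of_comp (g := cokMk R M X) ((cokMk_surjective R M).comp hf)

theorem cokMap_exact {f : X →ₗ[TensorRing R M] Y} {g : Y →ₗ[TensorRing R M] Z}
    (h : Function.Exact f g) (hg : Function.Surjective g) :
    Function.Exact (cokMap R M f) (cokMap R M g) := by
  refine LinearMap.exact_of_comp_of_mem_range ?_ ((cokMk_surjective R M).forall.2 fun y hy => ?_)
  · refine LinearMap.ext ((cokMk_surjective R M).forall.2 fun x => ?_)
    rw [LinearMap.comp_apply, cokMap_cokMk, cokMap_cokMk, h.apply_apply_eq_zero, map_zero,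
      LinearMap.zero_apply]
  · rw [cokMap_cokMk] at hy
    obtain ⟨t, ht⟩ := (exact_mulMap_cokMk R M _).1 hy
    obtain ⟨s, rfl⟩ := btmap_surjective R M (f := g.restrictScalars R) hg t
    rw [← map_mulMap] at ht
    obtain ⟨x, hx⟩ := (h (y - mulMap R M Y s)).1 (by rw [map_sub, ht, sub_self])
    refine ⟨cokMk R M X x, ?_⟩
    rw [cokMap_cokMk, hx, map_sub, (exact_mulMap_cokMk R M).apply_apply_eq_zero, sub_zero]

theorem cokMap_isShortExact {f : X →ₗ[TensorRing R M] Y} {g : Y →ₗ[TensorRing R M] Z}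
    (h : IsShortExact f g) (hZ : Function.Injective (mulMap R M Z)) :
    IsShortExact (cokMap R M f) (cokMap R M g) where
  injective := by
    rw [injective_iff_map_eq_zero]
    refine (cokMk_surjective R M).forall.2 fun x hx => ?_
    rw [cokMap_cokMk] at hx
    obtain ⟨t, ht⟩ := (exact_mulMap_cokMk R M _).1 hx
    have hgt : btmap R M (g.restrictScalars R) t = 0 := hZ <| by
      rw [← map_mulMap, ht, h.exact.apply_apply_eq_zero, map_zero]
    obtain ⟨s, rfl⟩ := (btmap_restrictScalars_exact R M h.exact h.surjective t).1 hgt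
    rw [← map_mulMap] at ht
    exact (exact_mulMap_cokMk R M x).2 ⟨s, h.injective ht⟩
  exact := cokMap_exact R M h.exact h.surjective
  surjective := cokMap_surjective R M h.surjective

theorem mulMap_injective_of_btmap_injective {f : X →ₗ[TensorRing R M] Y}
    (hf : Function.Injective (btmap R M (f.restrictScalars R)))
    (hY : Function.Injective (mulMap R M Y)) : Function.Injective (mulMap R M X) := by
  have : Function.Injective (f.restrictScalars R ∘ₗ mulMap R M X) := by
    rw [comp_mulMap]
    exact hY.comp hf
  exact Function.Injective.of_comp this

theorem mulMap_injective_of_cokMap_injective {f : X →ₗ[TensorRing R M] Y}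
    {g : Y →ₗ[TensorRing R M] Z} (h : IsShortExact f g)
    (hf : Function.Injective (cokMap R M f)) (hY : Function.Injective (mulMap R M Y)) :
    Function.Injective (mulMap R M Z) := by
  rw [injective_iff_map_eq_zero]
  refine (btmap_surjective R M (f := g.restrictScalars R) h.surjective).forall.2 fun s hs => ?_
  rw [← map_mulMap] at hs
  obtain ⟨x, hx⟩ := (h.exact _).1 hs
  have hcok : cokMk R M X x = 0 := hf <| by
    rw [cokMap_cokMk, hx, (exact_mulMap_cokMk R M).apply_apply_eq_zero, map_zero]
  obtain ⟨t, rfl⟩ := (exact_mulMap_cokMk R M _).1 hcok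
  rw [map_mulMap] at hx
  rw [← hY hx]
  exact (btmap_restrictScalars_exact R M h.exact h.surjective).apply_apply_eq_zero t

section Projective

variable (P : Type u) [AddCommGroup P] [Module R P]

/-- The isomorphism `Ind(P) / M Ind(P) ≅ P`. -/
def indCokEquiv : Cok R M (IndMod R M P) ≃ₗ[R] P :=
  (isShortExact_mulMap_indProj R M P).exact.linearEquivOfSurjective
    (isShortExact_mulMap_indProj R M P).surjective

variable (Q : Type u) [AddCommGroup Q] [Module R Q] [Module (TensorRing R M) Q]
  [IsScalarTower R (TensorRing R M) Q] [Module.Projective (TensorRing R M) Q]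

theorem mulMap_injective_of_projective : Function.Injective (mulMap R M Q) := by
  obtain ⟨F, _, _, s, r, -, h⟩ := exists_leftInverse_indMod (R := R) (M := M) Q
  have hrs : Function.LeftInverse (r.restrictScalars R) (s.restrictScalars R) := h
  exact mulMap_injective_of_btmap_injective R M (btmap_leftInverse R M hrs).injective
    (isShortExact_mulMap_indProj R M F).injective

instance cok_projective : Module.Projective R (Cok R M Q) := by
  obtain ⟨F, _, _, s, r, _, h⟩ := exists_leftInverse_indMod (R := R) (M := M) Q
  have : Module.Projective R (Cok R M (IndMod R M F)) :=
    Module.Projective.of_equiv (indCokEquiv R M F).symm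
  exact Module.Projective.of_split (cokMap R M s) (cokMap R M r)
    (LinearMap.ext (cokMap_leftInverse R M h))

end Projective

section Adjunction

variable {P : Type u} [AddCommGroup P] [Module R P]

theorem mulMap_trivMod : mulMap R M (TrivMod R M P) = 0 := PairMod.mulMap_eq _

/-- The adjunction `Hom_R(X / M X, P) ≅ Hom_{T_R(M)}(X, P)`, where `M` acts as zero on `P`. -/
def cokHomEquiv : (Cok R M X →ₗ[R] P) ≃ (X →ₗ[TensorRing R M] TrivMod R M P) where
  toFun φ :=
    let f : X →ₗ[R] TrivMod R M P := φ ∘ₗ cokMk R M X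
    homOfCommute f <| by
      rw [mulMap_trivMod, LinearMap.zero_comp]
      exact (LinearMap.comp_assoc _ _ _).trans <|
        (congrArg (φ ∘ₗ ·) (exact_mulMap_cokMk R M).linearMap_comp_eq_zero).trans φ.comp_zero
  invFun f :=
    let φ : X →ₗ[R] P := f.restrictScalars R
    (LinearMap.range (mulMap R M X)).liftQ φ <| LinearMap.range_le_ker_iff.2 <|
      (comp_mulMap R M f).trans <| by rw [mulMap_trivMod, LinearMap.zero_comp]; rfl
  left_inv φ := LinearMap.ext ((cokMk_surjective R M).forall.2 fun _ => rfl)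
  right_inv f := rfl

theorem cokHomEquiv_comp_cokMap (φ : Cok R M Y →ₗ[R] P) (f : X →ₗ[TensorRing R M] Y) :
    cokHomEquiv R M (φ ∘ₗ cokMap R M f) = cokHomEquiv R M φ ∘ₗ f := rfl

theorem exists_extension_trivMod_iff (f : X →ₗ[TensorRing R M] Y) :
    (∀ φ : X →ₗ[TensorRing R M] TrivMod R M P, ∃ ψ, ψ ∘ₗ f = φ) ↔
      ∀ φ : Cok R M X →ₗ[R] P, ∃ ψ, ψ ∘ₗ cokMap R M f = φ := by
  rw [← (cokHomEquiv R M).forall_congr_right]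
  refine forall_congr' fun φ => ?_
  rw [← (cokHomEquiv R M).exists_congr_right]
  simp only [← cokHomEquiv_comp_cokMap, EmbeddingLike.apply_eq_iff_eq]

end Adjunction

end Cokernel

/-! ### Nilpotent bimodules -/

section Nilpotent

variable {R : Type u} [Ring R]
variable {M : Type u} [AddCommGroup M] [Module R M] [Module Rᵐᵒᵖ M]
variable {X Y : Type u}
  [AddCommGroup X] [Module R X] [Module (TensorRing R M) X] [IsScalarTower R (TensorRing R M) X]
  [AddCommGroup Y] [Module R Y] [Module (TensorRing R M) Y] [IsScalarTower R (TensorRing R M) Y]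
variable {N : ℕ} (hN : IsNilpotentBimodule R M N)

include hN

/-- Nakayama's lemma. -/
theorem subsingleton_of_mulMap_surjective (h : Function.Surjective (mulMap R M X)) :
    Subsingleton X := by
  suffices ∀ i, Subsingleton (TensorPow R M i X) from this 0
  intro i
  induction i using hN.induction with
  | vanish _ vanish => exact vanish X
  | step i ih =>
    have : Subsingleton (BTensor R M (TensorPow R M i X)) := ih
    exact ((tensorPowMap_surjective M h i).comp
      (tensorPowComm R M X i).symm.surjective).subsingleton

theorem surjective_of_cokMap_surjective {f : X →ₗ[TensorRing R M] Y}
    (hf : Function.Surjective (cokMap R M f)) : Function.Surjective f := by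
  have hq := Submodule.mkQ_surjective (LinearMap.range f)
  have hcok := cokMap_exact R M (LinearMap.exact_map_mkQ_range f) hq
  have : Subsingleton (Y ⧸ LinearMap.range f) :=
    subsingleton_of_mulMap_surjective hN <| hq.forall.2 fun y => by
      obtain ⟨c, hc⟩ := hf (cokMk R M Y y)
      refine (exact_mulMap_cokMk R M _).1 ?_
      rw [← cokMap_cokMk, ← hc, hcok.apply_apply_eq_zero]
  rw [← LinearMap.range_eq_top]
  exact Submodule.Quotient.subsingleton_iff.1 this

theorem torVanish_tensorPow_of_cok (hX : Function.Injective (mulMap R M X))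
    (h : ∀ i, TorVanish R M (TensorPow R M i (Cok R M X))) (i : ℕ) :
    TorVanish R M (TensorPow R M i X) := by
  induction i using hN.induction with
  | vanish i vanish =>
    have := vanish X
    exact TorVanish.of_subsingleton
  | step i ih =>
    have hcok : IsShortExact (mulMap R M X) (cokMk R M X) :=
      ⟨hX, exact_mulMap_cokMk R M, cokMk_surjective R M⟩
    exact (ih.of_equiv (tensorPowComm R M X i).symm).of_isShortExact
      (tensorPowMap_isShortExact hcok h i) (h i)

theorem injective_of_tensorPowMap_cokMap_injective {f : X →ₗ[TensorRing R M] Y}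
    (hY : ∀ i, Function.Injective (tensorPowMap R M (mulMap R M Y) i))
    (hf : ∀ i, Function.Injective (tensorPowMap R M (cokMap R M f) i)) :
    Function.Injective f := by
  let fR : X →ₗ[R] Y := f.restrictScalars R
  suffices ∀ i, Function.Injective (tensorPowMap R M fR i) from this 0
  intro i
  induction i using hN.induction with
  | vanish i vanish =>
    have := vanish X
    exact Function.injective_of_subsingleton _
  | step i ih =>
    rw [injective_iff_map_eq_zero]
    intro y hy
    have hcok : tensorPowMap R M (cokMk R M X) i y = 0 := hf i <| by
      rw [← LinearMap.comp_apply, ← tensorPowMap_comp,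
        show cokMap R M f ∘ₗ cokMk R M X = cokMk R M Y ∘ₗ fR from rfl, tensorPowMap_comp,
        LinearMap.comp_apply, hy, map_zero, map_zero]
    obtain ⟨t, rfl⟩ :=
      (tensorPowMap_exact M (exact_mulMap_cokMk R M) (cokMk_surjective R M) i y).1 hcok
    have ht : tensorPowMap R M (btmap R M fR) i t = 0 := hY i <| by
      rw [← LinearMap.comp_apply, ← tensorPowMap_comp, ← comp_mulMap, tensorPowMap_comp,
        LinearMap.comp_apply, hy, map_zero]
    have hcomm : btmap R M (tensorPowMap R M fR i) (tensorPowComm R M X i t) = 0 :=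
      (LinearMap.congr_fun (tensorPowComm_comp_tensorPowMap_btmap R M fR i) t).symm.trans
        ((congrArg (tensorPowComm R M Y i) ht).trans (map_zero _))
    have ht' : tensorPowComm R M X i t = 0 := ih (hcomm.trans (map_zero _).symm)
    rw [(tensorPowComm R M X i).map_eq_zero_iff.1 ht', map_zero]

end Nilpotent

/-! ### Vanishing of `Ext¹` over the tensor ring -/

section ExtTensorRing

variable {R : Type u} [Ring R]
variable {M : Type u} [AddCommGroup M] [Module R M] [Module Rᵐᵒᵖ M]
variable {X : Type u} [AddCommGroup X] [Module R X] [Module (TensorRing R M) X]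
  [IsScalarTower R (TensorRing R M) X]

theorem extVanish_trivMod (hX : Function.Injective (mulMap R M X)) {P : Type u} [AddCommGroup P]
    [Module R P] (h : ExtVanish R (Cok R M X) P) :
    ExtVanish (TensorRing R M) X (TrivMod R M P) := by
  have hfree := isShortExact_subtype_ker
    (Finsupp.linearCombination_id_surjective (TensorRing R M) X)
  exact extVanish_of_exists_extension hfree <| (exists_extension_trivMod_iff R M _).2 <|
    h.exists_extension (cokMap_isShortExact R M hfree hX)

variable {N : ℕ} (hN : IsNilpotentBimodule R M N)

include hN

theorem extVanish_indMod (hX : Function.Injective (mulMap R M X)) {P : Type u} [AddCommGroup P]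
    [Module R P] (h : ∀ i, ExtVanish R (Cok R M X) (TensorPow R M i P)) :
    ExtVanish (TensorRing R M) X (IndMod R M P) :=
  hN.induction (p := fun i => ExtVanish (TensorRing R M) X (IndMod R M (TensorPow R M i P)))
    (fun i vanish =>
      have := vanish P
      have : Subsingleton (IndMod R M (TensorPow R M i P)) := indMod_subsingleton
      ExtVanish.of_subsingleton)
    (fun i ih => ExtVanish.of_isShortExact (isShortExact_indShift_indAug R M (TensorPow R M i P))
      ih (extVanish_trivMod hX (h i)))
    0

theorem extVanish_projective (hX : Function.Injective (mulMap R M X))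
    (h : ∀ (P : Type u) [AddCommGroup P] [Module R P], Module.Projective R P →
      ∀ i, ExtVanish R (Cok R M X) (TensorPow R M i P))
    {Q : Type u} [AddCommGroup Q] [Module R Q] [Module (TensorRing R M) Q]
    [IsScalarTower R (TensorRing R M) Q] [Module.Projective (TensorRing R M) Q] :
    ExtVanish (TensorRing R M) X Q := by
  obtain ⟨F, _, _, s, r, hF, hrs⟩ := exists_leftInverse_indMod (R := R) (M := M) Q
  exact (extVanish_indMod hN hX (h F hF)).of_leftInverse hrs

end ExtTensorRing

/-! ### Gorenstein projective modules over the tensor ring -/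

section BaseModule

variable {R : Type u} [Ring R]
variable {M : Type u} [AddCommGroup M] [Module R M] [Module Rᵐᵒᵖ M]
variable (X : ModuleCat.{u} (TensorRing R M))

/-- The `R`-module that underlies a `T_R(M)`-module. -/
abbrev baseModule : Module R X := Module.compHom X (baseHom R M)

attribute [local instance] baseModule

theorem baseModule_isScalarTower : IsScalarTower R (TensorRing R M) X where
  smul_assoc r t x := by
    rw [← base_mul, mul_smul]
    rfl

end BaseModule

attribute [local instance] baseModule baseModule_isScalarTower

section CompleteResolution

variable {R : Type u} [Ring R]
variable {M : Type u} [AddCommGroup M] [Module R M] [Module Rᵐᵒᵖ M]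
variable {Q : CompleteProjectiveResolution (TensorRing R M)}

section

variable (hQ : ∀ n, Function.Exact (btmap R M ((Q.d n).restrictScalars R))
  (btmap R M ((Q.d (n + 1)).restrictScalars R)))

include hQ

theorem btmap_subtype_ker_injective (n : ℤ) : Function.Injective
    (btmap R M ((LinearMap.ker (Q.d n)).subtype.restrictScalars R)) := by
  obtain ⟨k, rfl⟩ : ∃ k, n = k + 1 + 1 := ⟨n - 2, by lia⟩
  have hd : (Q.d (k + 1)).restrictScalars R =
      (LinearMap.ker (Q.d (k + 1 + 1))).subtype.restrictScalars R ∘ₗ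
        (Q.toKer (k + 1)).restrictScalars R := rfl
  have hzero : (Q.toKer (k + 1)).restrictScalars R ∘ₗ (Q.d k).restrictScalars R = 0 :=
    LinearMap.ext fun x => Subtype.ext ((Q.exact k).apply_apply_eq_zero x)
  have h := hQ k
  rw [hd, btmap_comp] at h
  refine injective_of_exact_comp h ?_
    (btmap_surjective R M (Q.isShortExact_toKer (k + 1)).surjective)
  rw [← btmap_comp, hzero, btmap_zero]

theorem mulMap_ker_injective (n : ℤ) :
    Function.Injective (mulMap R M (LinearMap.ker (Q.d n))) :=
  have := Q.projective n
  mulMap_injective_of_btmap_injective R M (btmap_subtype_ker_injective hQ n)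
    (mulMap_injective_of_projective R M (Q.X n))

theorem isCosyzygy_cok_ker
    (hTriv : ∀ P : ModuleCat.{u} R, Module.Projective R P → Q.IsHomExact (TrivMod R M P)) (n : ℤ) :
    IsCosyzygy (ModuleCat.of R (Cok R M (LinearMap.ker (Q.d n))))
      (ModuleCat.of R (Cok R M (LinearMap.ker (Q.d (n + 1))))) :=
  have := Q.projective n
  ⟨ModuleCat.of R (Cok R M (Q.X n)), cokMap R M (LinearMap.ker (Q.d n)).subtype,
    cokMap R M (Q.toKer n), cok_projective R M (Q.X n),
    cokMap_isShortExact R M (Q.isShortExact_toKer n) (mulMap_ker_injective hQ (n + 1)),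
    fun P hP => (exists_extension_trivMod_iff R M _).1 ((hTriv P hP).exists_extension n)⟩

end

theorem isHomExact_trivMod {P : Type u} [AddCommGroup P] [Module R P] [Module.Projective R P]
    (h : Q.IsHomExact (IndMod R M (BTensor R M P))) : Q.IsHomExact (TrivMod R M P) :=
  .of_isShortExact (isShortExact_indShift_indAug R M P) h
    (CompleteProjectiveResolution.isHomExact_of_projective
      (ModuleCat.of (TensorRing R M) (IndMod R M P)))

theorem gp_le_phi (hM : IsCompatible R M M) : GP (TensorRing R M) ≤ Phi R M (GP R) := by
  rintro X ⟨Q, ⟨e⟩⟩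
  obtain ⟨hQ, hHom⟩ := hM Q
  have hTriv (P : ModuleCat.{u} R) (hP : Module.Projective R P) : Q.IsHomExact (TrivMod R M P) :=
    isHomExact_trivMod fun n f => (hHom P hP n f).1
  have hinj : Function.Injective (btmap R M (e.toLinearMap.restrictScalars R)) :=
    (btmap_leftInverse R M (f := e.toLinearMap.restrictScalars R)
      (g := e.symm.toLinearMap.restrictScalars R) e.symm_apply_apply).injective
  have hX : Function.Injective (mulMap R M X) :=
    mulMap_injective_of_btmap_injective R M hinj (mulMap_ker_injective hQ 0)
  have hCok : GP R (ModuleCat.of R (Cok R M X)) := gp_iff_exists_isCosyzygy.2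
    ⟨fun n => ModuleCat.of R (Cok R M (LinearMap.ker (Q.d n))), ⟨cokCongr R M e⟩,
      isCosyzygy_cok_ker hQ hTriv⟩
  exact ⟨hX, hCok⟩

end CompleteResolution

section Lifting

variable {R : Type u} [Ring R]
variable {M : Type u} [AddCommGroup M] [Module R M] [Module Rᵐᵒᵖ M]
variable {X : Type u} [AddCommGroup X] [Module R X] [Module (TensorRing R M) X]
  [IsScalarTower R (TensorRing R M) X]
variable {P G : Type u} [AddCommGroup P] [Module R P] [AddCommGroup G] [Module R G]
variable {N : ℕ} (hN : IsNilpotentBimodule R M N)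

include hN

theorem exists_surjective_indMod [Module.Projective R P] {p : P →ₗ[R] Cok R M X}
    (hp : Function.Surjective p) : ∃ F : IndMod R M P →ₗ[TensorRing R M] X,
      Function.Surjective F ∧ cokMap R M F = p ∘ₗ (indCokEquiv R M P).toLinearMap := by
  obtain ⟨φ, hφ⟩ := Module.projective_lifting_property (cokMk R M X) p (cokMk_surjective R M)
  have hF : cokMap R M (indLift φ) = p ∘ₗ (indCokEquiv R M P).toLinearMap := by
    rw [← LinearMap.cancel_right (cokMk_surjective R M)]
    refine indMod_hom_ext_of_mulMap ?_ ?_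
    · exact (congrArg (cokMk R M X ∘ₗ ·) (indLift_comp_indBase φ)).trans <|
        hφ.trans (congrArg (p ∘ₗ ·) (indProj_comp_indBase R M P)).symm
    · rw [LinearMap.comp_assoc, LinearMap.comp_assoc,
        (exact_mulMap_cokMk R M).linearMap_comp_eq_zero, LinearMap.comp_zero, LinearMap.comp_zero]
  refine ⟨indLift φ, surjective_of_cokMap_surjective hN ?_, hF⟩
  rw [hF]
  exact hp.comp (indCokEquiv R M P).surjective

theorem exists_injective_indMod (hX : Function.Injective (mulMap R M X))
    {i : Cok R M X →ₗ[R] P} {p : P →ₗ[R] G} (h : IsShortExact i p)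
    (hG : ∀ j, TorVanish R M (TensorPow R M j G))
    (hP : ∀ j, ExtVanish R (Cok R M X) (TensorPow R M j P)) :
    ∃ f : X →ₗ[TensorRing R M] IndMod R M P,
      Function.Injective f ∧ (indCokEquiv R M P).toLinearMap ∘ₗ cokMap R M f = i := by
  have hMP (j : ℕ) : ExtVanish R (Cok R M X) (TensorPow R M j (BTensor R M P)) :=
    (hP (j + 1)).of_leftInverse (tensorPowComm R M P j).symm_apply_apply
  obtain ⟨f, hf⟩ := (extVanish_indMod hN hX hMP).exists_lift
    (isShortExact_indShift_indAug R M P) (cokHomEquiv R M i)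
  have hfi : (indCokEquiv R M P).toLinearMap ∘ₗ cokMap R M f = i := (cokHomEquiv R M).injective hf
  have hu : Function.LeftInverse (indTail R M P) (mulMap R M (IndMod R M P)) :=
    LinearMap.congr_fun (indTail_comp_mulMap R M P)
  refine ⟨f, injective_of_tensorPowMap_cokMap_injective hN
    (fun j => (tensorPowMap_leftInverse R M hu j).injective) fun j => ?_, hfi⟩
  have := (tensorPowMap_isShortExact h hG j).injective
  rw [← hfi, tensorPowMap_comp, LinearMap.coe_comp] at this
  exact this.of_comp

end Lifting

section Admissible

variable {R : Type u} [Ring R]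
variable {M : Type u} [AddCommGroup M] [Module R M] [Module Rᵐᵒᵖ M]

theorem phi_of_mulMap_injective (𝒳 : ObjectProperty (ModuleCat.{u} R)) (X : Type u)
    [AddCommGroup X] [inst : Module R X] [Module (TensorRing R M) X]
    [IsScalarTower R (TensorRing R M) X] (h : Function.Injective (mulMap R M X))
    (hc : 𝒳 (ModuleCat.of R (Cok R M X))) : Phi R M 𝒳 (ModuleCat.of (TensorRing R M) X) := by
  obtain rfl : inst = Module.compHom X (baseHom R M) :=
    Module.ext' _ _ fun r x => (baseHom_smul R M r x).symm
  exact ⟨h, hc⟩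

variable (ha : IsAdmissible R M)

include ha

theorem IsAdmissible.torVanish {G : ModuleCat.{u} R} (hG : GP R G) (i : ℕ) :
    TorVanish R M (TensorPow R M i G) :=
  torVanish_of_subsingleton_tor
    (ha G hG (ModuleCat.of R R) (inferInstanceAs (Module.Projective R R)) i).2

theorem IsAdmissible.extVanish {G : ModuleCat.{u} R} (hG : GP R G) (P : Type u) [AddCommGroup P]
    [Module R P] [hP : Module.Projective R P] (i : ℕ) : ExtVanish R G (TensorPow R M i P) :=
  (ha G hG (ModuleCat.of R P) hP i).1

variable {N : ℕ} (hN : IsNilpotentBimodule R M N)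

include hN

theorem isCosyzygy_of_isShortExact {W P V : Type u}
    [AddCommGroup W] [Module (TensorRing R M) W]
    [AddCommGroup P] [Module R P] [Module.Projective R P]
    [AddCommGroup V] [Module R V] [Module (TensorRing R M) V] [IsScalarTower R (TensorRing R M) V]
    {f : W →ₗ[TensorRing R M] IndMod R M P} {g : IndMod R M P →ₗ[TensorRing R M] V}
    (h : IsShortExact f g) (hV : Function.Injective (mulMap R M V))
    (hG : GP R (ModuleCat.of R (Cok R M V))) :
    IsCosyzygy (ModuleCat.of (TensorRing R M) W) (ModuleCat.of (TensorRing R M) V) :=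
  ⟨ModuleCat.of (TensorRing R M) (IndMod R M P), f, g,
    inferInstanceAs (Module.Projective (TensorRing R M) (IndMod R M P)), h,
    fun _ _ => (extVanish_projective hN hV fun P _ _ _ => ha.extVanish hG P).exists_extension h⟩

theorem exists_cosyzygy_of_phi {W : ModuleCat.{u} (TensorRing R M)} (hW : Phi R M (GP R) W) :
    ∃ V, Phi R M (GP R) V ∧ IsCosyzygy W V := by
  obtain ⟨hu, hG⟩ : Function.Injective (mulMap R M W) ∧ GP R (ModuleCat.of R (Cok R M W)) := hW
  obtain ⟨G', hG', P, i, p, _, h, -⟩ := hG.exists_cosyzygy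
  obtain ⟨f, hf, hfi⟩ := exists_injective_indMod hN hu h (ha.torVanish hG') (ha.extVanish hG P)
  let g := (LinearMap.range f).mkQ
  have hfg : IsShortExact f g :=
    ⟨hf, LinearMap.exact_map_mkQ_range f, Submodule.mkQ_surjective _⟩
  have hcok : Function.Injective (cokMap R M f) := by
    have := h.injective
    rw [← hfi, LinearMap.coe_comp] at this
    exact this.of_comp
  have hV := mulMap_injective_of_cokMap_injective R M hfg hcok
    (isShortExact_mulMap_indProj R M P).injective
  have hcokfg : IsShortExact (cokMap R M f) (cokMap R M g) :=
    ⟨hcok, cokMap_exact R M hfg.exact hfg.surjective, cokMap_surjective R M hfg.surjective⟩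
  have hi := hcokfg.congr (.refl R _) (indCokEquiv R M P) (.refl R _)
  rw [LinearEquiv.refl_toLinearMap, LinearMap.comp_id, hfi] at hi
  have hG'' := hG'.of_equiv (G' := ModuleCat.of R (Cok R M _)) (h.cokerEquiv hi)
  exact ⟨ModuleCat.of (TensorRing R M) _, phi_of_mulMap_injective _ _ hV hG'',
    isCosyzygy_of_isShortExact ha hN hfg hV hG''⟩

theorem exists_syzygy_of_phi {V : ModuleCat.{u} (TensorRing R M)} (hV : Phi R M (GP R) V) :
    ∃ W, Phi R M (GP R) W ∧ IsCosyzygy W V := by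
  obtain ⟨hu, hG⟩ : Function.Injective (mulMap R M V) ∧ GP R (ModuleCat.of R (Cok R M V)) := hV
  obtain ⟨G', hG', P, i, p, _, h, -⟩ := hG.exists_syzygy
  obtain ⟨F, hF, hFp⟩ := exists_surjective_indMod hN h.surjective
  let f := (LinearMap.ker F).subtype
  have hfF : IsShortExact f F := isShortExact_subtype_ker hF
  have hTor : TorVanish R M V := torVanish_tensorPow_of_cok hN hu (ha.torVanish hG) 0
  have hMf : Function.Injective (btmap R M (f.restrictScalars R)) :=
    hTor _ (F.restrictScalars R) ⟨hfF.injective, hfF.exact, hfF.surjective⟩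
  have hW := mulMap_injective_of_btmap_injective R M hMf
    (isShortExact_mulMap_indProj R M P).injective
  have hp := (cokMap_isShortExact R M hfF hu).congr (.refl R _) (indCokEquiv R M P) (.refl R _)
  rw [LinearEquiv.refl_toLinearMap, LinearEquiv.refl_toLinearMap, LinearMap.id_comp, hFp,
    LinearMap.comp_assoc, LinearEquiv.comp_symm, LinearMap.comp_id] at hp
  exact ⟨ModuleCat.of (TensorRing R M) _, phi_of_mulMap_injective _ _ hW
    (hG'.of_equiv (G' := ModuleCat.of R (Cok R M _)) (h.kerEquiv hp)),
    isCosyzygy_of_isShortExact ha hN hfF hu hG⟩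

theorem phi_le_gp : Phi R M (GP R) ≤ GP (TensorRing R M) :=
  le_gp_of_exists_isCosyzygy (fun _ => exists_cosyzygy_of_phi ha hN)
    fun _ => exists_syzygy_of_phi ha hN

end Admissible

end TensorRingGP

end

theorem mainTheorem3 (R : Type u) [Ring R]
    (M : Type u) [AddCommGroup M] [Module R M] [Module Rᵐᵒᵖ M] [SMulCommClass R Rᵐᵒᵖ M]
    (N : ℕ) (hN : TensorRingGP.IsNilpotentBimodule R M N)
    (hcompatible : TensorRingGP.IsCompatible R M M)
    (hadmissible : TensorRingGP.IsAdmissible R M) :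
    TensorRingGP.GP (TensorRingGP.TensorRing R M) =
      TensorRingGP.Phi R M (TensorRingGP.GP R) :=
  le_antisymm (TensorRingGP.gp_le_phi hcompatible) (TensorRingGP.phi_le_gp hadmissible hN)
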